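/- Let $(p_k)_{k\in\mathbb N}$ satisfy $p_k\ge 0$, $\sum_k p_k=1$, with $p_k>0$ for infinitely many $k$. For a word $r=r_1\dots r_j\in\mathbb N^j$ put $|r|=j$ and $p_r=p_{r_1}\cdots p_{r_j}$, and for $x>0$ put $\rho(x)=\#\{k:p_k\ge 1/x\}$ and $\rho_j(x)=\#\{r:|r|=j,\ p_r\ge 1/x\}$. In the Poissonized nested Karlin occupancy scheme, balls arrive at the times of a Poisson process $(\pi(t))_{t\ge 0}$ of unit intensity; the $n$-th ball carries letters $X_{n,1},X_{n,2},\dots$ and hits the box $X_{n,1}\dots X_{n,j}$ of the $j$-th generation for every $j\ge 1$, where all the letters $X_{n,i}$ are independent with distribution $(p_k)$ and independent of $\pi$. Let $K^{(j)}_t$ be the number of boxes $r$ with $|r|=j$ hit by at least one of the first $\pi(t)$ balls, and $\Phi_j(t)=\mathbb E K^{(j)}_t$. Assume that for some $\beta\ge 0$ and some $\ell$ slowly varying at $\infty$, $$\lim_{t\to\infty}\frac{\rho(\lambda t)-\rho(t)}{(\log t)^\beta\,\ell(\log t)}=\log\lambda\qquad\text{for all }\lambda>0,$$ and, if $\beta=0$,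 that in addition $\ell$ is eventually nondecreasing and $\ell(t)\to\infty$ as $t\to\infty$. Then, for every $j\in\mathbb N$: $K^{(j)}_t$ is integrable and $\Phi_j(t)=\sum_{|r|=j}(1-e^{-tp_r})$ for $t\ge 0$; the function $t\mapsto(\log t)^{j\beta+j-1}\ell(\log t)^j$ is slowly varying at $\infty$; $\Phi_j$ belongs to de Haan's class $\Pi$ with the same auxiliary function and constant as $\rho_j$, that is, for both $h=\Phi_j$ and $h=\rho_j$, $$\lim_{t\to\infty}\frac{h(\lambda t)-h(t)}{(\log t)^{j\beta+j-1}\,\ell(\log t)^j}=\frac{\Gamma(\beta+1)^j}{\Gamma(j(\beta+1))}\log\lambda\qquad\text{for all }\lambda>0;$$ and $\Phi_j$ is differentiable on $(0,\infty)$ with $$\Phi_j'(t)=\sum_{|r|=j}p_re^{-tp_r}\sim\frac{\Gamma(\beta+1)^j}{\Gamma(j(\beta+1))}\cdot\frac{(\log t)^{j\beta+j-1}\,\ell(\log t)^j}{t},\qquad t\to\infty.$$ -/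

import Mathlib

open MeasureTheory ProbabilityTheory Filter Topology
open scoped NNReal

namespace NestedKarlin

/-- `ℓ` is slowly varying at `∞`: it is positive and (Lebesgue) measurable on some half-line
`[X, ∞)`, and `ℓ (c t) / ℓ t → 1` as `t → ∞` for every `c > 0`. -/
def SlowlyVarying (ℓ : ℝ → ℝ) : Prop :=
  (∃ X : ℝ, AEMeasurable ℓ (volume.restrict (Set.Ici X)) ∧ ∀ t, X ≤ t → 0 < ℓ t) ∧
    ∀ c : ℝ, 0 < c → Tendsto (fun t => ℓ (c * t) / ℓ t) atTop (𝓝 1)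

/-- `h` belongs to de Haan's class `Π` with the auxiliary function `g` and constant `C`:
`g` is slowly varying at `∞`, and `(h (c t) - h t) / g t → C log c` for every `c > 0`.
(With `C = 1` this is membership in `Π` with auxiliary function `g`.) -/
def DeHaanPi (h g : ℝ → ℝ) (C : ℝ) : Prop :=
  SlowlyVarying g ∧
    ∀ c : ℝ, 0 < c →
      Tendsto (fun t => (h (c * t) - h t) / g t) atTop (𝓝 (C * Real.log c))

/-- Boxes of the first generation are indexed by `ℕ`; boxes of the `j`-th generation are the words
of length `j` over `ℕ`. The weight of a word is the product of the weights of its letters. -/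
def weight (p : ℕ → ℝ) {j : ℕ} (r : Fin j → ℕ) : ℝ := ∏ i, p (r i)

/-- `ρ x = #{k : p k ≥ 1/x}` (used for `x > 0`, where the set is finite if `∑ p k = 1`). -/
noncomputable def rho (p : ℕ → ℝ) (x : ℝ) : ℝ := (Set.ncard {k : ℕ | 1 / x ≤ p k} : ℝ)

/-- `ρ_j x = #{r : |r| = j, p_r ≥ 1/x}` (used for `x > 0`). -/
noncomputable def rhoGen (p : ℕ → ℝ) (j : ℕ) (x : ℝ) : ℝ :=
  (Set.ncard {r : Fin j → ℕ | 1 / x ≤ weight p r} : ℝ)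

section Scheme

variable {Ω : Type*} [MeasurableSpace Ω]

/-- `N` is a Poisson process on `[0, ∞)` of unit intensity. -/
structure IsUnitPoissonProcess (N : ℝ≥0 → Ω → ℕ) (μ : Measure Ω) : Prop where
  measurable : ∀ t, Measurable (N t)
  zero : ∀ ω, N 0 ω = 0
  monotone : ∀ ω, Monotone fun t => N t ω
  rightCont : ∀ ω t, ContinuousWithinAt (fun s => N s ω) (Set.Ici t) t
  indepIncrements : HasIndepIncrements N μ
  law : ∀ s t, s ≤ t → μ.map (fun ω => N t ω - N s ω) = poissonMeasure (t - s)

/-- The Poissonized nested Karlin occupancy scheme with box probabilities `p`: `N t` is the number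
of balls thrown up to time `t`, and the `n`-th ball (`n = 0, 1, …`) falls into the boxes with labels
`X n 0`, then `(X n 0, X n 1)`, then `(X n 0, X n 1, X n 2)`, … of the successive generations.
All letters `X n i` are independent with law `p`, and independent of the process `N`. -/
structure IsNestedScheme (p : ℕ → ℝ) (N : ℝ≥0 → Ω → ℕ) (X : ℕ → ℕ → Ω → ℕ)
    (μ : Measure Ω) : Prop where
  poisson : IsUnitPoissonProcess N μ
  measurable : ∀ n i, Measurable (X n i)
  law : ∀ n i k, μ {ω | X n i ω = k} = ENNReal.ofReal (p k)
  indep : iIndepFun (fun q : ℕ × ℕ => X q.1 q.2) μ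
  indepProcess :
    IndepFun (fun ω (t : ℝ≥0) => N t ω) (fun ω (q : ℕ × ℕ) => X q.1 q.2 ω) μ

/-- The number of boxes of generation `j` hit by at least one of the first `n` balls. -/
noncomputable def occupiedDet (X : ℕ → ℕ → Ω → ℕ) (j n : ℕ) (ω : Ω) : ℕ :=
  Set.ncard {r : Fin j → ℕ | ∃ m < n, ∀ i : Fin j, X m i ω = r i}

/-- `K_t^{(j)}`: the number of occupied boxes of generation `j` at time `t`, that is, after
`N t` balls have been thrown. -/
noncomputable def occupied (N : ℝ≥0 → Ω → ℕ) (X : ℕ → ℕ → Ω → ℕ) (j : ℕ) (t : ℝ≥0) (ω : Ω) : ℕ :=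
  occupiedDet X j (N t ω) ω

/-- `Φ_j t = E K_t^{(j)}` for `t ≥ 0` (extended by its value at `0` to `t < 0`). -/
noncomputable def meanOccupied (N : ℝ≥0 → Ω → ℕ) (X : ℕ → ℕ → Ω → ℕ) (μ : Measure Ω)
    (j : ℕ) (t : ℝ) : ℝ :=
  ∫ ω, (occupied N X j t.toNNReal ω : ℝ) ∂μ

end Scheme

/-- The constant `Γ(β+1)^j / Γ(j(β+1))`. -/
noncomputable def haanConst (β : ℝ) (j : ℕ) : ℝ :=
  Real.Gamma (β + 1) ^ j / Real.Gamma (j * (β + 1))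

/-- The function `(log t)^{jβ+j-1} ℓ(log t)^j`. -/
noncomputable def haanAux (β : ℝ) (ℓ : ℝ → ℝ) (j : ℕ) (t : ℝ) : ℝ :=
  Real.log t ^ ((j : ℝ) * β + (j : ℝ) - 1) * ℓ (Real.log t) ^ j

end NestedKarlin

namespace NestedKarlin

/-! In logarithmic scale the hypothesis says that the number of letters with `-log p_k` in a window
`(s - a, s]` is asymptotic to `a * u s`, where `u s = s ^ β * ℓ s`. Weights of words are products,
so their logarithms add, and the window count of a product family, averaged over a short shift, is
exactly the convolution of the window counts of its factors (`lintegral_windowCount_mul`). For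
regularly varying `A`, `B` of indices `α`, `β ≥ 0` this convolution behaves like a Beta value times
`s * A s * B s`, by dominated convergence under Potter bounds. Sandwiching windows between slightly
shorter and longer ones undoes the averaging (`HasWindowDensity.prod`). Induction on the generation
then gives the window density of words (`hasWindowDensity_weight`), with the Beta factors
telescoping to `haanConst`; this is the claim for `ρ_j`.

Since `1 - exp (-t w)` is the probability that a standard exponential variable is at most `t w`, the
increments of `Φ_j` in logarithmic scale are window counts smoothed by the density of the logarithm
of that variable. Its tails beat the Potter bounds, so smoothing does not change the limit
(`HasWindowDensity.tendsto_expectedOccupancy_sub`). The derivative follows from the concavity of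
`Φ_j` by a monotone density argument (`IsWeightFamily.tendsto_mul_deriv`). Probability enters only
in the series for the mean: given `n` balls, a box is missed with probability `(1 - p_r) ^ n`, and
this is averaged over the Poisson law. -/

/-! ### Uniform convergence and Potter bounds. -/

/-- Uniform convergence theorem for slowly varying functions, in additive form. -/
theorem eventually_abs_sub_le_of_tendsto_sub {h : ℝ → ℝ} (hm : Measurable h)
    (hlim : ∀ u, Tendsto (fun x => h (x + u) - h x) atTop (𝓝 0)) {ε : ℝ} (hε : 0 < ε) :
    ∀ᶠ x in atTop, ∀ u ∈ Set.Icc (0 : ℝ) 1, |h (x + u) - h x| ≤ ε := by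
  -- Pointwise convergence makes the measure of the bad increments in `[0, 2]` tend to `0`. The
  -- window has length `2` so that for `u ≤ 1` the part `[u, 2]` keeps length at least `1`.
  let bad : ℝ → Set ℝ := fun x => {u | ε / 2 ≤ |h (x + u) - h x|} ∩ Set.Icc 0 2
  have hbadm : ∀ x, MeasurableSet (bad x) := fun x =>
    (measurableSet_le measurable_const
      (((hm.comp (measurable_const_add x)).sub_const _).abs)).inter measurableSet_Icc
  have hvol : Tendsto (fun x => volume (bad x)) atTop (𝓝 0) := by
    have key := tendsto_lintegral_filter_of_dominated_convergence (μ := (volume : Measure ℝ))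
      (l := (atTop : Filter ℝ))
      (F := fun x => (bad x).indicator (fun _ => (1 : ENNReal))) (f := fun _ => 0)
      ((Set.Icc (0 : ℝ) 2).indicator fun _ => 1)
      (Eventually.of_forall fun x => measurable_const.indicator (hbadm x))
      (Eventually.of_forall fun x => ae_of_all _ fun u =>
        Set.indicator_le_indicator_of_subset Set.inter_subset_right (fun _ => by simp) u)
      (by simp [lintegral_indicator measurableSet_Icc])
      (ae_of_all _ fun u => by
        refine tendsto_const_nhds.congr' ?_
        have := (hlim u).abs
        rw [abs_zero] at this
        filter_upwards [this.eventually_lt_const (half_pos hε)] with x hx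
        symm
        exact Set.indicator_of_notMem (fun h' => absurd h'.1 (not_le.2 hx)) _)
    simpa [lintegral_indicator (hbadm _)] using key
  have hlt : ∀ᶠ x in atTop, volume (bad x) < ENNReal.ofReal (1 / 2) :=
    hvol.eventually_lt_const (by simp)
  obtain ⟨x₁, hx₁⟩ := eventually_atTop.1 hlt
  filter_upwards [eventually_ge_atTop x₁] with x hx u hu
  have h1 := hx₁ x hx
  have h2 := hx₁ (x + u) (by linarith [hu.1])
  -- The bad sets of `x` and of `x + u` have total measure below `1`, so some `x + t` is `ε /
  -- 2`-close in value to both base points.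
  have hne : ∃ t ∈ Set.Icc u 2, t ∉ bad x ∪ (fun t => t + -u) ⁻¹' bad (x + u) := by
    by_contra hcon
    push Not at hcon
    have hle : volume (Set.Icc u 2) ≤ volume (bad x ∪ (fun t => t + -u) ⁻¹' bad (x + u)) :=
      measure_mono hcon
    have hle2 := hle.trans (measure_union_le _ _)
    rw [measure_preimage_add_right, Real.volume_Icc] at hle2
    have : ENNReal.ofReal (2 - u) < ENNReal.ofReal (1 / 2) + ENNReal.ofReal (1 / 2) :=
      hle2.trans_lt (ENNReal.add_lt_add h1 h2)
    rw [← ENNReal.ofReal_add (by norm_num) (by norm_num)] at this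
    have := (ENNReal.ofReal_lt_ofReal_iff (by norm_num)).1 this
    linarith [hu.2]
  obtain ⟨t, ht, hnot⟩ := hne
  rw [Set.mem_union, not_or] at hnot
  have a1 : |h (x + t) - h x| < ε / 2 := by
    by_contra hc
    exact hnot.1 ⟨not_lt.1 hc, by linarith [ht.1, hu.1], ht.2⟩
  have a2 : |h (x + u + (t + -u)) - h (x + u)| < ε / 2 := by
    by_contra hc
    exact hnot.2 ⟨not_lt.1 hc, by linarith [ht.1], by linarith [ht.2, hu.1]⟩
  rw [show x + u + (t + -u) = x + t by ring] at a2
  rw [abs_lt] at a1 a2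
  rw [abs_le]
  constructor <;> linarith [a1.1, a1.2, a2.1, a2.2]

/-- Chain `⌊y - x⌋₊` unit steps and one fractional step; the latter costs the extra `1`. -/
theorem abs_sub_le_of_step {h : ℝ → ℝ} {ε x₁ : ℝ} (hε : 0 ≤ ε)
    (hstep : ∀ x, x₁ ≤ x → ∀ u ∈ Set.Icc (0 : ℝ) 1, |h (x + u) - h x| ≤ ε)
    {x y : ℝ} (hx : x₁ ≤ x) (hxy : x ≤ y) : |h y - h x| ≤ ε * (y - x + 1) := by
  have key : ∀ n : ℕ, ∀ x, x₁ ≤ x → |h (x + n) - h x| ≤ ε * n := by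
    intro n
    induction n with
    | zero => intro x _; simp
    | succ n ih =>
      intro x hx
      have h1 := ih x hx
      have h2 := hstep (x + n) (by have : (0 : ℝ) ≤ n := n.cast_nonneg; linarith) 1 (by simp)
      push_cast
      rw [show x + ((n : ℝ) + 1) = x + n + 1 by ring]
      calc |h (x + n + 1) - h x| = |(h (x + n + 1) - h (x + n)) + (h (x + n) - h x)| := by ring_nf
        _ ≤ _ := abs_add_le _ _
        _ ≤ ε * (n + 1) := by linarith
  have hfl := Nat.floor_le (sub_nonneg.2 hxy)
  have hlt := Nat.lt_floor_add_one (y - x)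
  set n := ⌊y - x⌋₊
  have h1 := key n x hx
  have h2 := hstep (x + n) (by have : (0 : ℝ) ≤ n := n.cast_nonneg; linarith) (y - x - n)
    ⟨by linarith, by linarith⟩
  rw [show x + n + (y - x - n) = y by ring] at h2
  calc |h y - h x| = |(h y - h (x + n)) + (h (x + n) - h x)| := by ring_nf
    _ ≤ _ := abs_add_le _ _
    _ ≤ ε * (n + 1) := by linarith
    _ ≤ ε * (y - x + 1) := by gcongr

/-- Potter bounds in additive form. -/
theorem exists_potter_bound {f : ℝ → ℝ} (hm : Measurable f)
    (hbdd : ∀ x₁, ∃ M, ∀ x ≤ x₁, f x ≤ M) (hpos : ∀ᶠ x in atTop, 0 < f x) {β : ℝ} (hβ : 0 ≤ β)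
    (hlim : ∀ u, Tendsto (fun x => f (x + u) / f x) atTop (𝓝 (Real.exp (β * u))))
    {ε : ℝ} (hε : 0 < ε) :
    ∃ C, 0 < C ∧ ∀ᶠ x in atTop,
      (∀ y ≤ x, f y ≤ C * Real.exp (ε * (x - y)) * f x) ∧
      ∀ y ≥ x, f y ≤ C * Real.exp ((β + ε) * (y - x)) * f x := by
  -- Taking logarithms and removing the linear drift leaves a function with vanishing increments.
  let h : ℝ → ℝ := fun x => Real.log (f x) - β * x
  have hh : ∀ u, Tendsto (fun x => h (x + u) - h x) atTop (𝓝 0) := by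
    intro u
    have h1 := ((hlim u).log (Real.exp_pos _).ne').sub_const (β * u)
    rw [Real.log_exp, sub_self] at h1
    refine h1.congr' ?_
    filter_upwards [hpos, (tendsto_atTop_add_const_right _ u tendsto_id).eventually hpos]
      with x hx hxu
    simp only [id] at hxu
    rw [Real.log_div hxu.ne' hx.ne']
    simp only [h]
    ring
  have huc := eventually_abs_sub_le_of_tendsto_sub
    (h := h) ((Real.measurable_log.comp hm).sub (measurable_id.const_mul β)) hh hε
  obtain ⟨x₁, hx₁⟩ := eventually_atTop.1 (huc.and hpos)
  have hstep : ∀ x, x₁ ≤ x → ∀ u ∈ Set.Icc (0 : ℝ) 1, |h (x + u) - h x| ≤ ε :=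
    fun x hx => (hx₁ x hx).1
  have hp : ∀ x, x₁ ≤ x → 0 < f x := fun x hx => (hx₁ x hx).2
  have hexp : ∀ x, x₁ ≤ x → f x = Real.exp (h x + β * x) := by
    intro x hx
    simp only [h, sub_add_cancel]
    rw [Real.exp_log (hp x hx)]
  have down : ∀ x y, x₁ ≤ y → y ≤ x → f y ≤ Real.exp ε * Real.exp (ε * (x - y)) * f x := by
    intro x y hy hyx
    have := abs_le.1 (abs_sub_le_of_step hε.le hstep hy hyx)
    rw [hexp x (hy.trans hyx), hexp y hy, ← Real.exp_add, ← Real.exp_add]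
    apply Real.exp_le_exp.2
    nlinarith [this.1, mul_le_mul_of_nonneg_left hyx hβ]
  have up : ∀ x y, x₁ ≤ x → x ≤ y → f y ≤ Real.exp ε * Real.exp ((β + ε) * (y - x)) * f x := by
    intro x y hx hxy
    have := abs_le.1 (abs_sub_le_of_step hε.le hstep hx hxy)
    rw [hexp x hx, hexp y (hx.trans hxy), ← Real.exp_add, ← Real.exp_add]
    apply Real.exp_le_exp.2
    nlinarith [this.2]
  -- Below `x₁` only the crude bound `M` is available; comparing it with `f x₁` costs the factor `M
  -- / f x₁ ≥ 1`.
  obtain ⟨M, hM⟩ := hbdd x₁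
  have hf1 := hp x₁ le_rfl
  have hM0 : f x₁ ≤ M := hM x₁ le_rfl
  have hMf : 1 ≤ M / f x₁ := by rw [le_div_iff₀ hf1]; linarith
  refine ⟨M / f x₁ * Real.exp ε, by positivity, ?_⟩
  filter_upwards [eventually_ge_atTop x₁] with x hx
  have hfx := hp x hx
  constructor
  · intro y hy
    rcases le_total x₁ y with h1 | h1
    · refine (down x y h1 hy).trans ?_
      gcongr
      exact le_mul_of_one_le_left (Real.exp_pos _).le hMf
    · calc f y ≤ M := hM y h1
        _ = M / f x₁ * f x₁ := by field_simp
        _ ≤ M / f x₁ * (Real.exp ε * Real.exp (ε * (x - x₁)) * f x) := by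
            gcongr; exact down x x₁ le_rfl hx
        _ ≤ M / f x₁ * (Real.exp ε * Real.exp (ε * (x - y)) * f x) := by gcongr
        _ = _ := by ring
  · intro y hy
    refine (up x y hx hy).trans ?_
    gcongr
    exact le_mul_of_one_le_left (Real.exp_pos _).le hMf

/-! ### Regular variation and convolutions. -/

/-- A nonnegative measurable function, vanishing on the negative half-line and bounded on left
half-lines, that is regularly varying of index `β` at `∞`. -/
structure IsRegularlyVarying (f : ℝ → ℝ) (β : ℝ) : Prop where
  measurable : Measurable f
  nonneg : ∀ x, 0 ≤ f x
  eq_zero_of_neg : ∀ x < 0, f x = 0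
  bounded : ∀ x₁, ∃ M, ∀ x ≤ x₁, f x ≤ M
  eventually_pos : ∀ᶠ x in atTop, 0 < f x
  tendsto : ∀ c, 0 < c → Tendsto (fun x => f (c * x) / f x) atTop (𝓝 (c ^ β))

/-- Downward Potter bound for `f ∘ exp`. The exponent `-1/4` is integrable at `0`, which is what
domination of the convolution requires. -/
theorem IsRegularlyVarying.exists_le_rpow {f : ℝ → ℝ} {β : ℝ} (hf : IsRegularlyVarying f β)
    (hβ : 0 ≤ β) :
    ∃ C, 0 < C ∧ ∀ᶠ s in atTop, ∀ y ∈ Set.Ioo (0 : ℝ) 1,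
      f (s * y) ≤ C * y ^ (-(1 / 4) : ℝ) * f s := by
  obtain ⟨C, hC, h⟩ := exists_potter_bound (f := fun x => f (Real.exp x))
    (hf.measurable.comp Real.measurable_exp)
    (fun x₁ => by
      obtain ⟨M, hM⟩ := hf.bounded (Real.exp x₁)
      exact ⟨M, fun x hx => hM _ (Real.exp_le_exp.2 hx)⟩)
    (Real.tendsto_exp_atTop.eventually hf.eventually_pos) hβ
    (fun u => by
      have := (hf.tendsto (Real.exp u) (Real.exp_pos u)).comp Real.tendsto_exp_atTop
      rw [← Real.exp_mul, mul_comm] at this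
      refine this.congr fun x => ?_
      simp only [Function.comp_apply, ← Real.exp_add]
      rw [add_comm])
    (ε := 1 / 4) (by norm_num)
  refine ⟨C, hC, ?_⟩
  filter_upwards [Real.tendsto_log_atTop.eventually h, eventually_gt_atTop 0] with s hs hs0 y hy
  have h1 := hs.1 (Real.log s + Real.log y)
    (by linarith [Real.log_nonpos hy.1.le hy.2.le])
  rw [Real.exp_add, Real.exp_log hs0, Real.exp_log hy.1] at h1
  rw [Real.rpow_def_of_pos hy.1]
  convert h1 using 4
  ring

/-- The integrand is `beta a b` times the density of the Beta distribution, whose total mass is one.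
-/
theorem integrable_indicator_rpow_mul_rpow {a b : ℝ} (ha : 0 < a) (hb : 0 < b) :
    Integrable ((Set.Ioo (0 : ℝ) 1).indicator fun y => y ^ (a - 1) * (1 - y) ^ (b - 1)) ∧
      ∫ y, (Set.Ioo (0 : ℝ) 1).indicator (fun y => y ^ (a - 1) * (1 - y) ^ (b - 1)) y =
        beta a b := by
  have hpos := beta_pos ha hb
  have heq : ((Set.Ioo (0 : ℝ) 1).indicator fun y => y ^ (a - 1) * (1 - y) ^ (b - 1)) =
      fun y => beta a b * betaPDFReal a b y := by
    funext y
    by_cases hy : y ∈ Set.Ioo (0 : ℝ) 1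
    · rw [Set.indicator_of_mem hy, betaPDFReal, if_pos (show 0 < y ∧ y < 1 from hy)]
      field_simp
    · rw [Set.indicator_of_notMem hy, betaPDFReal, if_neg (show ¬(0 < y ∧ y < 1) from hy), mul_zero]
  have hnn : 0 ≤ᵐ[volume] betaPDFReal a b := ae_of_all _ fun y => by
    by_cases hy : 0 < y ∧ y < 1
    · exact (betaPDFReal_pos hy.1 hy.2 ha hb).le
    · simp [betaPDFReal, hy]
  have hl : ∫⁻ y, ENNReal.ofReal (betaPDFReal a b y) = 1 := lintegral_betaPDF_eq_one ha hb
  have hint : Integrable (betaPDFReal a b) := by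
    refine ⟨(measurable_betaPDFReal a b).aestronglyMeasurable, ?_⟩
    rw [hasFiniteIntegral_iff_ofReal hnn, hl]
    exact ENNReal.one_lt_top
  rw [heq]
  refine ⟨hint.const_mul _, ?_⟩
  rw [integral_const_mul, integral_eq_lintegral_of_nonneg_ae hnn
    (measurable_betaPDFReal a b).aestronglyMeasurable, hl]
  simp

/-- Asymptotics of the convolution of two regularly varying functions of nonnegative indices. -/
theorem IsRegularlyVarying.tendsto_convolution {A B : ℝ → ℝ} {α β : ℝ}
    (hA : IsRegularlyVarying A α) (hB : IsRegularlyVarying B β) (hα : 0 ≤ α) (hβ : 0 ≤ β) :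
    Tendsto (fun s => (∫ t, A (s - t) * B t) / (s * A s * B s)) atTop
      (𝓝 (beta (β + 1) (α + 1))) := by
  obtain ⟨C₁, hC₁, h₁⟩ := hA.exists_le_rpow hα
  obtain ⟨C₂, hC₂, h₂⟩ := hB.exists_le_rpow hβ
  have hlim := (integrable_indicator_rpow_mul_rpow (a := β + 1) (b := α + 1)
    (by linarith) (by linarith)).2
  have hbd := (integrable_indicator_rpow_mul_rpow (a := 3 / 4) (b := 3 / 4)
    (by norm_num) (by norm_num)).1
  -- At these two points one factor is evaluated at `0`, where neither the Potter bound nor the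
  -- vanishing on negative arguments applies.
  have hne : ∀ᵐ y : ℝ, y ≠ 0 ∧ y ≠ 1 := by
    rw [ae_iff]
    refine measure_mono_null (t := {0, 1}) ?_ ((Set.finite_singleton _).insert _ |>.measure_zero _)
    intro y hy
    simp only [Set.mem_ofPred_eq, not_and_or, not_not] at hy
    simpa using hy
  -- After `t = s * y` the integrand lives on `[0, 1]`, converges to the Beta integrand, and is
  -- dominated by a multiple of `y ^ (-1/4) * (1 - y) ^ (-1/4)`, the Beta integrand with parameters
  -- `3/4, 3/4`.
  have key := tendsto_integral_filter_of_dominated_convergence (μ := (volume : Measure ℝ))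
    (l := (atTop : Filter ℝ))
    (F := fun s y => A (s - s * y) * B (s * y) / (A s * B s))
    (f := (Set.Ioo (0 : ℝ) 1).indicator fun y => y ^ (β + 1 - 1) * (1 - y) ^ (α + 1 - 1))
    (fun y => C₁ * C₂ *
      (Set.Ioo (0 : ℝ) 1).indicator (fun y => y ^ (3 / 4 - 1 : ℝ) * (1 - y) ^ (3 / 4 - 1 : ℝ)) y)
    (Eventually.of_forall fun s => by
      refine Measurable.aestronglyMeasurable ?_
      exact ((hA.measurable.comp (by fun_prop)).mul (hB.measurable.comp (by fun_prop))).div_const _)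
    (by
      filter_upwards [h₁, h₂, hA.eventually_pos, hB.eventually_pos, eventually_gt_atTop 0]
        with s h₁ h₂ hAs hBs hs
      filter_upwards [hne] with y hy
      rw [Real.norm_of_nonneg (div_nonneg (mul_nonneg (hA.nonneg _) (hB.nonneg _))
        (mul_pos hAs hBs).le)]
      by_cases hy' : y ∈ Set.Ioo (0 : ℝ) 1
      · rw [Set.indicator_of_mem hy', div_le_iff₀ (mul_pos hAs hBs)]
        have e1 := h₁ (1 - y) ⟨by linarith [hy'.2], by linarith [hy'.1]⟩
        have e2 := h₂ y hy'
        rw [show s - s * y = s * (1 - y) by ring]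
        refine (mul_le_mul e1 e2 (hB.nonneg _) ((hA.nonneg _).trans e1)).trans_eq ?_
        norm_num
        ring
      · rw [Set.indicator_of_notMem hy', mul_zero]
        apply le_of_eq
        rcases lt_or_ge y 0 with h | h
        · rw [hB.eq_zero_of_neg _ (by nlinarith)]; simp
        · have : 1 < y := by
            by_contra hc
            exact hy' ⟨lt_of_le_of_ne h (Ne.symm hy.1), lt_of_le_of_ne (not_lt.1 hc) hy.2⟩
          rw [hA.eq_zero_of_neg _ (by nlinarith)]; simp)
    (hbd.const_mul _)
    (by
      filter_upwards [hne] with y hy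
      by_cases hy' : y ∈ Set.Ioo (0 : ℝ) 1
      · rw [Set.indicator_of_mem hy']
        have e1 := hA.tendsto (1 - y) (by linarith [hy'.2])
        have e2 := hB.tendsto y hy'.1
        simp only [add_sub_cancel_right]
        rw [mul_comm]
        refine (e1.mul e2).congr fun s => ?_
        rw [show s - s * y = (1 - y) * s by ring, mul_comm s y, div_mul_div_comm]
      · rw [Set.indicator_of_notMem hy']
        refine tendsto_const_nhds.congr' ?_
        filter_upwards [eventually_gt_atTop 0] with s hs
        rcases lt_or_ge y 0 with h | h
        · rw [hB.eq_zero_of_neg _ (by nlinarith)]; simp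
        · have : 1 < y := by
            by_contra hc
            exact hy' ⟨lt_of_le_of_ne h (Ne.symm hy.1), lt_of_le_of_ne (not_lt.1 hc) hy.2⟩
          rw [hA.eq_zero_of_neg _ (by nlinarith)]; simp)
  rw [hlim] at key
  refine key.congr' ?_
  filter_upwards [eventually_gt_atTop 0] with s hs
  rw [integral_div, Measure.integral_comp_mul_left (fun t => A (s - t) * B t) s, smul_eq_mul,
    abs_of_pos (inv_pos.2 hs)]
  field_simp

/-! ### Window counts and product families. -/

/-- The number of indices `i` with `s - a < -log (w i) ≤ s`. -/
noncomputable def windowCount {I : Type*} (w : I → ℝ) (a s : ℝ) : ENNReal :=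
  ∑' i, (Set.Ico (Real.exp (-s)) (Real.exp (a - s))).indicator 1 (w i)

/-- A summable family of weights in `[0, 1]`. -/
structure IsWeightFamily {I : Type*} (w : I → ℝ) : Prop where
  nonneg : ∀ i, 0 ≤ w i
  le_one : ∀ i, w i ≤ 1
  summable : Summable w

section WindowCount

variable {I J : Type*} {w : I → ℝ} {w' : J → ℝ}

theorem measurable_windowCount_term (c a : ℝ) :
    Measurable fun s => (Set.Ico (Real.exp (-s)) (Real.exp (a - s))).indicator
      (1 : ℝ → ENNReal) c := by
  have h1 : Measurable fun s : ℝ => Real.exp (-s) := by fun_prop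
  have h2 : Measurable fun s : ℝ => Real.exp (a - s) := by fun_prop
  have h3 : MeasurableSet ({s : ℝ | Real.exp (-s) ≤ c} ∩ {s | c < Real.exp (a - s)}) :=
    (measurableSet_le h1 measurable_const).inter (measurableSet_lt measurable_const h2)
  exact measurable_const.indicator h3 (f := fun _ => (1 : ENNReal))

theorem measurable_windowCount [Countable I] (w : I → ℝ) (a : ℝ) :
    Measurable (windowCount w a) :=
  Measurable.tsum fun i => measurable_windowCount_term (w i) a

/-- Markov's inequality: an index in the window has `exp s * w i ≥ 1`. -/
theorem windowCount_le (w : I → ℝ) (a s : ℝ) :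
    windowCount w a s ≤ ENNReal.ofReal (Real.exp s) * ∑' i, ENNReal.ofReal (w i) := by
  rw [← ENNReal.tsum_mul_left]
  refine ENNReal.tsum_le_tsum fun i => ?_
  refine Set.indicator_apply_le' (fun h => ?_) fun _ => by simp
  rw [← ENNReal.ofReal_mul (Real.exp_pos _).le, Pi.one_apply, ← ENNReal.ofReal_one]
  refine ENNReal.ofReal_le_ofReal ?_
  calc (1 : ℝ) = Real.exp s * Real.exp (-s) := by rw [← Real.exp_add]; simp
    _ ≤ _ := by gcongr; exact h.1

theorem IsWeightFamily.tsum_ne_top (hw : IsWeightFamily w) : ∑' i, ENNReal.ofReal (w i) ≠ ⊤ := by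
  rw [← ENNReal.ofReal_tsum_of_nonneg hw.nonneg hw.summable]
  exact ENNReal.ofReal_ne_top

theorem IsWeightFamily.windowCount_ne_top (hw : IsWeightFamily w) (a s : ℝ) :
    windowCount w a s ≠ ⊤ :=
  ne_top_of_le_ne_top (ENNReal.mul_ne_top ENNReal.ofReal_ne_top hw.tsum_ne_top)
    (windowCount_le w a s)

theorem IsWeightFamily.windowCount_eq_zero (hw : IsWeightFamily w) (a : ℝ) {s : ℝ} (hs : s < 0) :
    windowCount w a s = 0 := by
  refine ENNReal.tsum_eq_zero.2 fun i => Set.indicator_of_notMem (fun h => ?_) _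
  have := Real.one_lt_exp_iff.2 (neg_pos.2 hs)
  linarith [h.1, hw.le_one i]

/-- The assumptions say `(s - a, s] ⊆ (s' - a', s']`. -/
theorem windowCount_mono (w : I → ℝ) {a a' s s' : ℝ} (hs : s ≤ s') (ha : s' - a' ≤ s - a) :
    windowCount w a s ≤ windowCount w a' s' :=
  ENNReal.tsum_le_tsum fun i => Set.indicator_le_indicator_of_subset
    (Set.Ico_subset_Ico (Real.exp_le_exp.2 (by linarith)) (Real.exp_le_exp.2 (by linarith)))
    (fun _ => by simp) _

theorem windowCount_add (w : I → ℝ) {a b : ℝ} (ha : 0 ≤ a) (hb : 0 ≤ b) (s : ℝ) :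
    windowCount w (a + b) (s + b) = windowCount w a s + windowCount w b (s + b) := by
  unfold windowCount
  rw [← ENNReal.tsum_add]
  refine tsum_congr fun i => ?_
  rw [show a + b - (s + b) = a - s by ring, show b - (s + b) = -s by ring,
    ← Set.Ico_union_Ico_eq_Ico (b := Real.exp (-s)) (Real.exp_le_exp.2 (by linarith))
      (Real.exp_le_exp.2 (by linarith)), Set.indicator_union_of_disjoint]
  · exact add_comm _ _
  · rw [Set.disjoint_left]
    intro x hx hx'
    exact absurd hx.2 (not_lt.2 hx'.1)

theorem windowCount_comp_equiv (e : J ≃ I) (w : I → ℝ) (a s : ℝ) :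
    windowCount (fun j => w (e j)) a s = windowCount w a s :=
  e.tsum_eq fun i => (Set.Ico (Real.exp (-s)) (Real.exp (a - s))).indicator 1 (w i)

theorem indicator_Ico_exp_mul (c y a s : ℝ) :
    (Set.Ico (Real.exp (-s)) (Real.exp (a - s))).indicator (1 : ℝ → ENNReal) (c * Real.exp (-y)) =
      (Set.Ico (Real.exp (-(s - y))) (Real.exp (a - (s - y)))).indicator 1 c := by
  have h1 : Real.exp (-(s - y)) = Real.exp (-s) * Real.exp y := by rw [← Real.exp_add]; ring_nf
  have h2 : Real.exp (a - (s - y)) = Real.exp (a - s) * Real.exp y := by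
    rw [← Real.exp_add]; ring_nf
  simp only [Set.indicator_apply, Set.mem_Ico, h1, h2, Real.exp_neg y, ← div_eq_mul_inv,
    le_div_iff₀ (Real.exp_pos y), div_lt_iff₀ (Real.exp_pos y), Pi.one_apply]

theorem windowCount_mul_exp (w : I → ℝ) (y a s : ℝ) :
    windowCount (fun i => w i * Real.exp (-y)) a s = windowCount w a (s - y) :=
  tsum_congr fun i => indicator_Ico_exp_mul (w i) y a s

/-- The convolution of two window counts averages the window count of the product family. -/
theorem lintegral_windowCount_mul [Countable I] [Countable J] (hw' : ∀ j, 0 ≤ w' j)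
    (a δ s : ℝ) :
    ∫⁻ t, windowCount w a (s - t) * windowCount w' δ t =
      ∫⁻ x in Set.Ico 0 δ, windowCount (fun q : I × J => w q.1 * w' q.2) a (s - x) := by
  have hL : ∀ t, windowCount w a (s - t) * windowCount w' δ t = ∑' j, windowCount w a (s - t) *
      (Set.Ico (Real.exp (-t)) (Real.exp (δ - t))).indicator 1 (w' j) := fun t => by
    rw [ENNReal.tsum_mul_left]; rfl
  have hR : ∀ x, windowCount (fun q : I × J => w q.1 * w' q.2) a (s - x) =
      ∑' j, windowCount (fun i => w i * w' j) a (s - x) := fun x => by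
    unfold windowCount
    rw [ENNReal.tsum_prod', ENNReal.tsum_comm]
  have hmeas : Measurable fun t => windowCount w a (s - t) :=
    (measurable_windowCount w a).comp (measurable_const.sub measurable_id)
  simp only [hL, hR]
  rw [lintegral_tsum (f := fun j t => windowCount w a (s - t) *
      (Set.Ico (Real.exp (-t)) (Real.exp (δ - t))).indicator 1 (w' j))
      fun j => (hmeas.mul (measurable_windowCount_term _ _)).aemeasurable,
    lintegral_tsum (f := fun j x => windowCount (fun i => w i * w' j) a (s - x))
      fun j => ((measurable_windowCount _ a).comp
      (measurable_const.sub measurable_id)).aemeasurable]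
  refine tsum_congr fun j => ?_
  rcases (hw' j).eq_or_lt with h0 | h0
  · have e1 : ∀ t, (Set.Ico (Real.exp (-t)) (Real.exp (δ - t))).indicator
        (1 : ℝ → ENNReal) (w' j) = 0 := fun t =>
      Set.indicator_of_notMem (fun h => by have := h.1; have := Real.exp_pos (-t); linarith) _
    have e2 : ∀ x, windowCount (fun i => w i * w' j) a (s - x) = 0 := fun x => by
      refine ENNReal.tsum_eq_zero.2 fun i => Set.indicator_of_notMem (fun h => ?_) _
      have h1 : Real.exp (-(s - x)) ≤ w i * w' j := h.1
      have := Real.exp_pos (-(s - x))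
      rw [← h0, mul_zero] at h1
      linarith
    simp [e1, e2]
  -- An index at height `y = -log (w' j)` lies in the window of length `δ` at `t` exactly when `y ≤
  -- t < y + δ`; the substitution `t = x + y` then matches both sides.
  · obtain ⟨y, hy⟩ : ∃ y, w' j = Real.exp (-y) := ⟨-Real.log (w' j), by
      rw [neg_neg, Real.exp_log h0]⟩
    rw [hy]
    simp only [windowCount_mul_exp]
    have e1 : ∀ t, windowCount w a (s - t) * (Set.Ico (Real.exp (-t)) (Real.exp (δ - t))).indicator
        (1 : ℝ → ENNReal) (Real.exp (-y)) =
        (Set.Ico 0 δ).indicator (fun x => windowCount w a (s - x - y)) (t - y) := by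
      intro t
      simp only [Set.indicator_apply, Set.mem_Ico, Real.exp_le_exp, Real.exp_lt_exp, Pi.one_apply,
        mul_ite, mul_one, mul_zero, sub_sub, sub_add_cancel]
      refine if_congr ⟨fun h => ⟨?_, ?_⟩, fun h => ⟨?_, ?_⟩⟩ rfl rfl <;> linarith [h.1, h.2]
    simp only [e1]
    rw [lintegral_sub_right_eq_self
      (fun t => (Set.Ico 0 δ).indicator (fun x => windowCount w a (s - x - y)) t) y,
      lintegral_indicator measurableSet_Ico]

theorem IsWeightFamily.prod (hw : IsWeightFamily w) (hw' : IsWeightFamily w') :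
    IsWeightFamily fun q : I × J => w q.1 * w' q.2 where
  nonneg _ := mul_nonneg (hw.nonneg _) (hw'.nonneg _)
  le_one _ := mul_le_one₀ (hw.le_one _) (hw'.nonneg _) (hw'.le_one _)
  summable := hw.summable.mul_of_nonneg hw'.summable hw.nonneg hw'.nonneg

/-- Every window count of `w` is asymptotic to `u` times the length of the window. -/
def HasWindowDensity (w : I → ℝ) (u : ℝ → ℝ) : Prop :=
  (∀ᶠ s in atTop, 0 < u s) ∧
    ∀ a, 0 < a → Tendsto (fun s => (windowCount w a s).toReal / u s) atTop (𝓝 a)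

theorem HasWindowDensity.eventually_pos {u : ℝ → ℝ} (h : HasWindowDensity w u) {a : ℝ}
    (ha : 0 < a) : ∀ᶠ s in atTop, 0 < (windowCount w a s).toReal := by
  filter_upwards [h.1, (h.2 a ha).eventually_const_lt ha] with s hs h1
  exact (div_pos_iff_of_pos_right hs).1 h1

/-- Additivity of windows forces `u` to be flat: for `b > 0` the count in `(s - 1, s]` is asymptotic
to `u s`, and also, as the difference of windows of lengths `1 + b` and `b` ending at `s + b`, to `u
(s + b)`. -/
theorem HasWindowDensity.tendsto_add_div {u : ℝ → ℝ} (hw : IsWeightFamily w)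
    (h : HasWindowDensity w u) (b : ℝ) : Tendsto (fun s => u (s + b) / u s) atTop (𝓝 1) := by
  have pos : ∀ b, 0 < b → Tendsto (fun s => u (s + b) / u s) atTop (𝓝 1) := by
    intro b hb
    have hsh : Tendsto (fun s : ℝ => s + b) atTop atTop :=
      tendsto_atTop_add_const_right _ b tendsto_id
    have h1 := (h.2 (1 + b) (by linarith)).comp hsh
    have h2 := (h.2 b hb).comp hsh
    have h3 := h.2 1 one_pos
    have h4 := h3.div (h1.sub h2) (by simp)
    rw [add_sub_cancel_right, div_one] at h4
    refine h4.congr' ?_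
    filter_upwards [h.1, hsh.eventually h.1, h.eventually_pos one_pos] with s hs hs' hp
    simp only [Function.comp_apply, Pi.div_apply]
    rw [windowCount_add w zero_le_one hb.le, ENNReal.toReal_add (hw.windowCount_ne_top _ _)
      (hw.windowCount_ne_top _ _), ← sub_div, add_sub_cancel_right]
    field_simp
  rcases lt_trichotomy b 0 with hb | rfl | hb
  · have h1 := ((pos (-b) (by linarith)).comp
      (tendsto_atTop_add_const_right atTop b tendsto_id)).inv₀ one_ne_zero
    rw [inv_one] at h1
    refine h1.congr fun s => ?_
    simp
  · refine tendsto_const_nhds.congr' ?_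
    filter_upwards [h.1] with s hs
    rw [add_zero, div_self hs.ne']
  · exact pos b hb

theorem HasWindowDensity.isRegularlyVarying [Countable I] {u : ℝ → ℝ} (hw : IsWeightFamily w)
    (h : HasWindowDensity w u) {β : ℝ}
    (hu : ∀ c, 0 < c → Tendsto (fun s => u (c * s) / u s) atTop (𝓝 (c ^ β)))
    {a : ℝ} (ha : 0 < a) : IsRegularlyVarying (fun s => (windowCount w a s).toReal) β where
  measurable := (measurable_windowCount w a).ennreal_toReal
  nonneg _ := ENNReal.toReal_nonneg
  eq_zero_of_neg x hx := by rw [hw.windowCount_eq_zero a hx, ENNReal.toReal_zero]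
  bounded x₁ := ⟨(ENNReal.ofReal (Real.exp x₁) * ∑' i, ENNReal.ofReal (w i)).toReal, fun x hx =>
    ENNReal.toReal_mono (ENNReal.mul_ne_top ENNReal.ofReal_ne_top hw.tsum_ne_top)
      ((windowCount_le w a x).trans (by gcongr))⟩
  eventually_pos := h.eventually_pos ha
  tendsto c hc := by
    have hsc : Tendsto (fun s : ℝ => c * s) atTop atTop := tendsto_id.const_mul_atTop hc
    have h1 := (((h.2 a ha).comp hsc).mul (hu c hc)).div (h.2 a ha) ha.ne'
    rw [mul_div_cancel_left₀ _ ha.ne'] at h1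
    refine h1.congr' ?_
    filter_upwards [h.1, hsc.eventually h.1, h.eventually_pos ha] with s h1 h2 h3
    simp only [Function.comp_apply, Pi.div_apply]
    field_simp

/-- Window densities of product families. -/
theorem HasWindowDensity.prod [Countable I] [Countable J] {u v : ℝ → ℝ} (hw : IsWeightFamily w)
    (hw' : IsWeightFamily w') (hu : HasWindowDensity w u) (hv : HasWindowDensity w' v)
    {α β : ℝ} (hα : 0 ≤ α) (hβ : 0 ≤ β)
    (hu' : ∀ c, 0 < c → Tendsto (fun s => u (c * s) / u s) atTop (𝓝 (c ^ α)))
    (hv' : ∀ c, 0 < c → Tendsto (fun s => v (c * s) / v s) atTop (𝓝 (c ^ β))) :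
    HasWindowDensity (fun q : I × J => w q.1 * w' q.2)
      fun s => beta (β + 1) (α + 1) * (s * u s * v s) := by
  have hB : 0 < beta (β + 1) (α + 1) := beta_pos (by linarith) (by linarith)
  set g : ℝ → ℝ := fun s => beta (β + 1) (α + 1) * (s * u s * v s) with hg
  set W : I × J → ℝ := fun q => w q.1 * w' q.2
  have hW : IsWeightFamily W := hw.prod hw'
  have hgpos : ∀ᶠ s in atTop, 0 < g s := by
    filter_upwards [hu.1, hv.1, eventually_gt_atTop 0] with s h1 h2 h3
    positivity
  have hgadd : ∀ b, Tendsto (fun s => g (s + b) / g s) atTop (𝓝 1) := by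
    intro b
    have h1 : Tendsto (fun s : ℝ => (s + b) / s) atTop (𝓝 1) := by
      have : Tendsto (fun s : ℝ => 1 + b / s) atTop (𝓝 (1 + 0)) :=
        tendsto_const_nhds.add (tendsto_const_nhds.div_atTop tendsto_id)
      rw [add_zero] at this
      refine this.congr' ?_
      filter_upwards [eventually_gt_atTop 0] with s hs
      field_simp
    have h2 := (h1.mul (hu.tendsto_add_div hw b)).mul (hv.tendsto_add_div hw' b)
    rw [one_mul, one_mul] at h2
    refine h2.congr fun s => ?_
    simp only [hg]
    rw [mul_div_mul_left _ _ hB.ne', div_mul_div_comm, div_mul_div_comm]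
  -- `M a δ s` is the shift-averaged count computed by the convolution. Every window occurring in it
  -- lies in `(s - a - δ, s]`, and those occurring in `M (a + δ) δ (s + δ)` contain `(s - a, s]`,
  -- whence the two bounds.
  let M : ℝ → ℝ → ℝ → ENNReal := fun a δ s => ∫⁻ x in Set.Ico 0 δ, windowCount W a (s - x)
  have hMle : ∀ a δ s, M a δ s ≤ windowCount W (a + δ) s * ENNReal.ofReal δ := by
    intro a δ s
    calc M a δ s ≤ ∫⁻ _ in Set.Ico 0 δ, windowCount W (a + δ) s :=
          setLIntegral_mono measurable_const fun x hx =>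
            windowCount_mono W (by linarith [hx.1]) (by linarith [hx.2])
      _ = _ := by simp
  have hleM : ∀ a δ s, windowCount W a s * ENNReal.ofReal δ ≤ M (a + δ) δ (s + δ) := by
    intro a δ s
    calc windowCount W a s * ENNReal.ofReal δ = ∫⁻ _ in Set.Ico 0 δ, windowCount W a s := by simp
      _ ≤ M (a + δ) δ (s + δ) :=
          setLIntegral_mono' measurableSet_Ico fun x hx =>
            windowCount_mono W (by linarith [hx.2]) (by linarith [hx.1])
  have hMtop : ∀ a δ s, M a δ s ≠ ⊤ := fun a δ s =>
    ne_top_of_le_ne_top (ENNReal.mul_ne_top (hW.windowCount_ne_top _ _) ENNReal.ofReal_ne_top)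
      (hMle a δ s)
  have hM : ∀ a δ, 0 < a → 0 < δ → Tendsto (fun s => (M a δ s).toReal / g s) atTop
      (𝓝 (a * δ)) := by
    intro a δ ha hδ
    have rA := hu.isRegularlyVarying hw hu' ha
    have rB := hv.isRegularlyVarying hw' hv' hδ
    have h1 := rA.tendsto_convolution rB hα hβ
    have h2 := ((h1.div_const (beta (β + 1) (α + 1))).mul ((hu.2 a ha).mul (hv.2 δ hδ)))
    rw [div_self hB.ne', one_mul] at h2
    refine h2.congr' ?_
    filter_upwards [hu.eventually_pos ha, hv.eventually_pos hδ, hu.1, hv.1, eventually_gt_atTop 0]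
      with s p1 p2 p3 p4 p5
    have hint : ∫ t, (windowCount w a (s - t)).toReal * (windowCount w' δ t).toReal =
        (M a δ s).toReal := by
      have hm : Measurable fun t => (windowCount w a (s - t)).toReal *
          (windowCount w' δ t).toReal :=
        (rA.measurable.comp (measurable_const.sub measurable_id)).mul rB.measurable
      rw [integral_eq_lintegral_of_nonneg_ae
        (ae_of_all _ fun t => mul_nonneg (rA.nonneg _) (rB.nonneg _))
        hm.aestronglyMeasurable]
      congr 1
      refine Eq.trans ?_ (lintegral_windowCount_mul hw'.nonneg a δ s)
      refine lintegral_congr fun t => ?_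
      rw [← ENNReal.toReal_mul, ENNReal.ofReal_toReal
        (ENNReal.mul_ne_top (hw.windowCount_ne_top _ _) (hw'.windowCount_ne_top _ _))]
    rw [hint]
    simp only [hg]
    field_simp
  refine ⟨hgpos, fun a ha => tendsto_order.2 ⟨fun b hb => ?_, fun b hb => ?_⟩⟩
  · obtain ⟨δ, hδ, hδ'⟩ : ∃ δ, 0 < δ ∧ δ < a ∧ b < a - δ := by
      refine ⟨min (a / 2) ((a - b) / 2), by simp; constructor <;> linarith, ?_, ?_⟩
      · linarith [min_le_left (a / 2) ((a - b) / 2)]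
      · linarith [min_le_right (a / 2) ((a - b) / 2)]
    have h1 := hM (a - δ) δ (by linarith [hδ'.1]) hδ
    filter_upwards [h1.eventually_const_lt (mul_lt_mul_of_pos_right hδ'.2 hδ), hgpos] with s hs hgs
    have h2 := ENNReal.toReal_mono
      (ENNReal.mul_ne_top (hW.windowCount_ne_top _ _) ENNReal.ofReal_ne_top) (hMle (a - δ) δ s)
    rw [sub_add_cancel, ENNReal.toReal_mul, ENNReal.toReal_ofReal hδ.le] at h2
    rw [lt_div_iff₀ hgs] at hs ⊢
    refine lt_of_mul_lt_mul_right ?_ hδ.le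
    linarith
  · obtain ⟨δ, hδ, hδ'⟩ : ∃ δ, 0 < δ ∧ a + δ < b := ⟨(b - a) / 2, by linarith, by linarith⟩
    have h1 := ((hM (a + δ) δ (by linarith) hδ).comp
      (tendsto_atTop_add_const_right atTop δ tendsto_id)).mul (hgadd δ)
    rw [mul_one] at h1
    filter_upwards [h1.eventually_lt_const (mul_lt_mul_of_pos_right hδ' hδ), hgpos,
      (tendsto_atTop_add_const_right atTop δ tendsto_id).eventually hgpos] with s hs hgs hgs'
    simp only [id, Function.comp_apply] at hs hgs'
    rw [div_mul_div_cancel₀ hgs'.ne'] at hs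
    have h2 := ENNReal.toReal_mono (hMtop _ _ _) (hleM a δ s)
    rw [ENNReal.toReal_mul, ENNReal.toReal_ofReal hδ.le] at h2
    rw [div_lt_iff₀ hgs] at hs ⊢
    refine lt_of_mul_lt_mul_right ?_ hδ.le
    linarith

end WindowCount

/-! ### The smoothing kernel. -/

theorem integrable_exp_neg_half_abs : Integrable fun x : ℝ => Real.exp (-(|x| / 2)) := by
  rw [← integrableOn_univ, ← Set.Iic_union_Ioi (a := (0 : ℝ))]
  refine IntegrableOn.union ?_ ?_
  · refine (integrableOn_exp_mul_Iic (a := 1 / 2) (by norm_num) 0).congr_fun (fun x hx => ?_)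
      measurableSet_Iic
    simp only
    rw [abs_of_nonpos hx]
    ring_nf
  · refine (integrableOn_exp_mul_Ioi (a := -(1 / 2)) (by norm_num) 0).congr_fun (fun x hx => ?_)
      measurableSet_Ioi
    simp only
    rw [abs_of_pos hx]
    ring_nf

/-- The density of the logarithm of a standard exponential random variable. -/
noncomputable def gumbelDensity (x : ℝ) : ℝ := Real.exp x * Real.exp (-Real.exp x)

theorem gumbelDensity_nonneg (x : ℝ) : 0 ≤ gumbelDensity x := by
  unfold gumbelDensity; positivity

theorem continuous_gumbelDensity : Continuous gumbelDensity := by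
  unfold gumbelDensity; fun_prop

theorem hasDerivAt_neg_exp_neg_exp (x : ℝ) :
    HasDerivAt (fun x => -Real.exp (-Real.exp x)) (gumbelDensity x) x := by
  have := ((Real.hasDerivAt_exp x).fun_neg.exp).fun_neg
  refine this.congr_deriv ?_
  unfold gumbelDensity
  ring

/-- The factor `exp (|x| / 2)` is the loss in the Potter bound with `ε = 1 / 2`. On the right `exp y
≥ y ^ 2 / 2` at `y = exp x` absorbs it; on the left the factor `exp x` does. -/
theorem exp_half_abs_mul_gumbelDensity_le (x : ℝ) :
    Real.exp (|x| / 2) * gumbelDensity x ≤ 2 * Real.exp (-(|x| / 2)) := by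
  unfold gumbelDensity
  rcases le_total 0 x with hx | hx
  · rw [abs_of_nonneg hx]
    have h1 := Real.quadratic_le_exp_of_nonneg (Real.exp_pos x).le
    have h2 : Real.exp (-Real.exp x) ≤ 2 * Real.exp (-(2 * x)) := by
      rw [Real.exp_neg, Real.exp_neg, ← div_eq_mul_inv, two_mul, Real.exp_add,
        inv_le_iff_one_le_mul₀ (Real.exp_pos _), div_mul_eq_mul_div, le_div_iff₀ (by positivity)]
      nlinarith [Real.exp_pos x]
    calc Real.exp (x / 2) * (Real.exp x * Real.exp (-Real.exp x))
        ≤ Real.exp (x / 2) * (Real.exp x * (2 * Real.exp (-(2 * x)))) := by gcongr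
      _ = 2 * (Real.exp (x / 2) * Real.exp x * Real.exp (-(2 * x))) := by ring
      _ = 2 * Real.exp (-(x / 2)) := by
          rw [← Real.exp_add, ← Real.exp_add]; ring_nf
  · rw [abs_of_nonpos hx]
    have h2 : Real.exp (-Real.exp x) ≤ 1 := Real.exp_le_one_iff.2 (by linarith [Real.exp_pos x])
    calc Real.exp (-x / 2) * (Real.exp x * Real.exp (-Real.exp x))
        ≤ Real.exp (-x / 2) * (Real.exp x * 1) := by gcongr
      _ = Real.exp (-(-x / 2)) := by rw [mul_one, ← Real.exp_add]; ring_nf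
      _ ≤ _ := by linarith [Real.exp_pos (-(-x / 2))]

theorem integrable_exp_half_abs_mul_gumbelDensity :
    Integrable fun x => Real.exp (|x| / 2) * gumbelDensity x := by
  refine (integrable_exp_neg_half_abs.const_mul 2).mono' ?_ (ae_of_all _ fun x => ?_)
  · exact (Continuous.mul (by fun_prop) continuous_gumbelDensity).aestronglyMeasurable
  · rw [Real.norm_of_nonneg (mul_nonneg (Real.exp_pos _).le (gumbelDensity_nonneg x))]
    exact exp_half_abs_mul_gumbelDensity_le x

theorem integral_gumbelDensity : ∫ x, gumbelDensity x = 1 := by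
  have hint : Integrable gumbelDensity := by
    refine integrable_exp_half_abs_mul_gumbelDensity.mono'
      continuous_gumbelDensity.aestronglyMeasurable (ae_of_all _ fun x => ?_)
    rw [Real.norm_of_nonneg (gumbelDensity_nonneg x)]
    exact le_mul_of_one_le_left (gumbelDensity_nonneg x) (Real.one_le_exp (by positivity))
  have hbot : Tendsto (fun x => -Real.exp (-Real.exp x)) atBot (𝓝 (-1)) := by
    have h0 : Tendsto (fun x : ℝ => -Real.exp x) atBot (𝓝 (-0)) := Real.tendsto_exp_atBot.neg
    rw [neg_zero] at h0
    have := (Real.continuous_exp.tendsto 0).comp h0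
    rw [Real.exp_zero] at this
    exact this.neg
  have htop : Tendsto (fun x => -Real.exp (-Real.exp x)) atTop (𝓝 0) := by
    have := (Real.tendsto_exp_neg_atTop_nhds_zero.comp Real.tendsto_exp_atTop).neg
    rwa [neg_zero] at this
  rw [integral_of_hasDerivAt_of_tendsto hasDerivAt_neg_exp_neg_exp hint hbot htop]
  norm_num

/-! ### Expected occupancy: smoothing and the monotone density argument. -/

section ExpectedOccupancy

variable {I : Type*} {w : I → ℝ}

/-- The expected number of boxes with weights `w` that are occupied at time `t`. -/
noncomputable def expectedOccupancy (w : I → ℝ) (t : ℝ) : ℝ := ∑' i, (1 - Real.exp (-(t * w i)))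

theorem IsWeightFamily.summable_one_sub_exp (hw : IsWeightFamily w) {t : ℝ} (ht : 0 ≤ t) :
    Summable fun i => 1 - Real.exp (-(t * w i)) := by
  refine (hw.summable.mul_left t).of_nonneg_of_le (fun i => ?_) fun i => ?_
  · have := mul_nonneg ht (hw.nonneg i)
    linarith [Real.exp_le_one_iff.2 (neg_nonpos.2 this)]
  · linarith [Real.add_one_le_exp (-(t * w i))]

theorem IsWeightFamily.summable_mul_exp (hw : IsWeightFamily w) {t : ℝ} (ht : 0 ≤ t) :
    Summable fun i => w i * Real.exp (-(t * w i)) := by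
  refine hw.summable.of_nonneg_of_le (fun i => ?_) fun i => ?_
  · exact mul_nonneg (hw.nonneg i) (Real.exp_pos _).le
  · refine mul_le_of_le_one_right (hw.nonneg i) (Real.exp_le_one_iff.2 ?_)
    exact neg_nonpos.2 (mul_nonneg ht (hw.nonneg i))

/-- Termwise differentiation: on `(0, ∞)` the derivatives are dominated by the summable `w`. -/
theorem IsWeightFamily.hasDerivAt_expectedOccupancy (hw : IsWeightFamily w) {t : ℝ} (ht : 0 < t) :
    HasDerivAt (expectedOccupancy w) (∑' i, w i * Real.exp (-(t * w i))) t := by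
  refine hasDerivAt_tsum_of_isPreconnected (u := w) (t := Set.Ioi 0)
    (g := fun i t => 1 - Real.exp (-(t * w i))) (g' := fun i t => w i * Real.exp (-(t * w i)))
    hw.summable isOpen_Ioi
    isPreconnected_Ioi (fun i y _ => ?_) (fun i y hy => ?_) (Set.mem_Ioi.2 ht)
    (hw.summable_one_sub_exp ht.le) (Set.mem_Ioi.2 ht)
  · have := (((hasDerivAt_id y).mul_const (w i)).fun_neg.exp).const_sub 1
    refine this.congr_deriv ?_
    simp only [id]
    ring
  · rw [Real.norm_of_nonneg (mul_nonneg (hw.nonneg i) (Real.exp_pos _).le)]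
    refine mul_le_of_le_one_right (hw.nonneg i) (Real.exp_le_one_iff.2 ?_)
    exact neg_nonpos.2 (mul_nonneg (le_of_lt hy) (hw.nonneg i))

/-- For `c = exp (-y)` the indicator restricts `x` to `(s - a - y, s - y]`, and `-exp (-exp x)` is a
primitive of the density. -/
theorem lintegral_indicator_mul_gumbelDensity {c : ℝ} (hc : 0 ≤ c) {a : ℝ} (ha : 0 ≤ a) (s : ℝ) :
    ∫⁻ x, (Set.Ico (Real.exp (-(s - x))) (Real.exp (a - (s - x)))).indicator 1 c *
      ENNReal.ofReal (gumbelDensity x) =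
    ENNReal.ofReal ((1 - Real.exp (-(Real.exp s * c))) -
      (1 - Real.exp (-(Real.exp (s - a) * c)))) := by
  rcases hc.eq_or_lt with rfl | h0
  · have e1 : ∀ x, (Set.Ico (Real.exp (-(s - x))) (Real.exp (a - (s - x)))).indicator
        (1 : ℝ → ENNReal) 0 = 0 := fun x =>
      Set.indicator_of_notMem (fun h => by have := h.1; have := Real.exp_pos (-(s - x)); linarith) _
    simp only [e1]
    simp
  · obtain ⟨y, rfl⟩ : ∃ y, c = Real.exp (-y) := ⟨-Real.log c, by
      rw [neg_neg, Real.exp_log h0]⟩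
    have e1 : ∀ x, (Set.Ico (Real.exp (-(s - x))) (Real.exp (a - (s - x)))).indicator
        (1 : ℝ → ENNReal) (Real.exp (-y)) * ENNReal.ofReal (gumbelDensity x) =
        (Set.Ioc (s - a - y) (s - y)).indicator (fun x => ENNReal.ofReal (gumbelDensity x)) x := by
      intro x
      simp only [Set.indicator_apply, Set.mem_Ico, Set.mem_Ioc, Real.exp_le_exp, Real.exp_lt_exp,
        Pi.one_apply, ite_mul, one_mul, zero_mul]
      refine if_congr ⟨fun h => ⟨?_, ?_⟩, fun h => ⟨?_, ?_⟩⟩ rfl rfl <;> linarith [h.1, h.2]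
    simp only [e1]
    rw [lintegral_indicator measurableSet_Ioc, ← ofReal_integral_eq_lintegral_ofReal
      ((continuous_gumbelDensity.integrableOn_Icc).mono_set Set.Ioc_subset_Icc_self)
      (ae_of_all _ gumbelDensity_nonneg),
      ← intervalIntegral.integral_of_le (by linarith),
      intervalIntegral.integral_eq_sub_of_hasDerivAt (fun x _ => hasDerivAt_neg_exp_neg_exp x)
        (continuous_gumbelDensity.intervalIntegrable _ _),
      ← Real.exp_add, ← Real.exp_add, ← sub_eq_add_neg, ← sub_eq_add_neg]
    congr 1
    ring

theorem lintegral_windowCount_mul_gumbelDensity [Countable I] (hw : IsWeightFamily w) {a : ℝ}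
    (ha : 0 ≤ a) (s : ℝ) :
    ∫⁻ x, windowCount w a (s - x) * ENNReal.ofReal (gumbelDensity x) =
      ENNReal.ofReal
        (expectedOccupancy w (Real.exp s) - expectedOccupancy w (Real.exp (s - a))) := by
  have hL : ∀ x, windowCount w a (s - x) * ENNReal.ofReal (gumbelDensity x) =
      ∑' i, (Set.Ico (Real.exp (-(s - x))) (Real.exp (a - (s - x)))).indicator 1 (w i) *
        ENNReal.ofReal (gumbelDensity x) := fun x => by
    rw [ENNReal.tsum_mul_right]; rfl
  simp only [hL]
  rw [lintegral_tsum (f := fun i x => (Set.Ico (Real.exp (-(s - x)))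
    (Real.exp (a - (s - x)))).indicator 1 (w i) * ENNReal.ofReal (gumbelDensity x))
    fun i => (((measurable_windowCount_term (w i) a).comp
    (measurable_const.sub measurable_id)).mul
      continuous_gumbelDensity.measurable.ennreal_ofReal).aemeasurable]
  simp only [lintegral_indicator_mul_gumbelDensity (hw.nonneg _) ha]
  unfold expectedOccupancy
  rw [← (hw.summable_one_sub_exp (Real.exp_pos s).le).tsum_sub
    (hw.summable_one_sub_exp (Real.exp_pos (s - a)).le), ENNReal.ofReal_tsum_of_nonneg]
  · intro i
    have h1 : Real.exp (s - a) * w i ≤ Real.exp s * w i :=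
      mul_le_mul_of_nonneg_right (Real.exp_le_exp.2 (by linarith)) (hw.nonneg i)
    linarith [Real.exp_le_exp.2 (neg_le_neg h1)]
  · exact (hw.summable_one_sub_exp (Real.exp_pos s).le).sub
      (hw.summable_one_sub_exp (Real.exp_pos (s - a)).le)

theorem HasWindowDensity.tendsto_expectedOccupancy_sub [Countable I] {u : ℝ → ℝ}
    (hw : IsWeightFamily w) (h : HasWindowDensity w u) {a : ℝ} (ha : 0 < a) :
    Tendsto (fun s => (expectedOccupancy w (Real.exp s) - expectedOccupancy w (Real.exp (s - a))) /
      u s) atTop (𝓝 a) := by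
  set D : ℝ → ℝ := fun s => (windowCount w a s).toReal with hD
  have hDm : Measurable D := (measurable_windowCount w a).ennreal_toReal
  have hDlim : ∀ b, Tendsto (fun s => D (s + b) / u s) atTop (𝓝 a) := by
    intro b
    have hsh : Tendsto (fun s : ℝ => s + b) atTop atTop :=
      tendsto_atTop_add_const_right _ b tendsto_id
    have h1 := ((h.2 a ha).comp hsh).mul (h.tendsto_add_div hw b)
    rw [mul_one] at h1
    refine h1.congr' ?_
    filter_upwards [hsh.eventually h.1] with s hs
    simp only [Function.comp_apply, hD]
    field_simp
  -- The count is slowly varying under shifts, hence index `0`; the growth `exp (|x| / 2)` is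
  -- integrable against the kernel.
  obtain ⟨C, hC, hpot⟩ := exists_potter_bound hDm
    (fun x₁ => ⟨(ENNReal.ofReal (Real.exp x₁) * ∑' i, ENNReal.ofReal (w i)).toReal, fun x hx =>
      ENNReal.toReal_mono (ENNReal.mul_ne_top ENNReal.ofReal_ne_top hw.tsum_ne_top)
        ((windowCount_le w a x).trans (by gcongr))⟩)
    (h.eventually_pos ha) le_rfl
    (fun b => by
      have h1 := (hDlim b).div (h.2 a ha) ha.ne'
      rw [div_self ha.ne'] at h1
      rw [zero_mul, Real.exp_zero]
      refine h1.congr' ?_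
      filter_upwards [h.1] with s hs
      simp only [Pi.div_apply, hD]
      field_simp)
    (ε := 1 / 2) (by norm_num)
  have key := tendsto_integral_filter_of_dominated_convergence (μ := (volume : Measure ℝ))
    (l := (atTop : Filter ℝ)) (F := fun s x => D (s - x) * gumbelDensity x / u s)
    (f := fun x => a * gumbelDensity x)
    (fun x => C * (a + 1) * (Real.exp (|x| / 2) * gumbelDensity x))
    (Eventually.of_forall fun s => (((hDm.comp (measurable_const.sub measurable_id)).mul
      continuous_gumbelDensity.measurable).div_const _).aestronglyMeasurable)
    (by
      filter_upwards [hpot, h.1, (h.2 a ha).eventually_lt_const (lt_add_one a)]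
        with s hpot hus hDs
      refine ae_of_all _ fun x => ?_
      rw [Real.norm_of_nonneg (div_nonneg (mul_nonneg ENNReal.toReal_nonneg
        (gumbelDensity_nonneg x)) hus.le), div_le_iff₀ hus]
      rw [div_lt_iff₀ hus] at hDs
      have h1 : D (s - x) ≤ C * Real.exp (|x| / 2) * D s := by
        rcases le_total 0 x with hx | hx
        · refine (hpot.1 (s - x) (by linarith)).trans_eq ?_
          rw [abs_of_nonneg hx]
          ring_nf
        · refine (hpot.2 (s - x) (by linarith)).trans_eq ?_
          rw [abs_of_nonpos hx]
          ring_nf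
      have h2 : D (s - x) ≤ C * Real.exp (|x| / 2) * ((a + 1) * u s) :=
        h1.trans (by gcongr)
      calc D (s - x) * gumbelDensity x
          ≤ C * Real.exp (|x| / 2) * ((a + 1) * u s) * gumbelDensity x :=
            mul_le_mul_of_nonneg_right h2 (gumbelDensity_nonneg x)
        _ = _ := by ring)
    (integrable_exp_half_abs_mul_gumbelDensity.const_mul _)
    (ae_of_all _ fun x => by
      refine ((hDlim (-x)).mul_const (gumbelDensity x)).congr fun s => ?_
      rw [← sub_eq_add_neg]
      ring)
  rw [integral_const_mul, integral_gumbelDensity, mul_one] at key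
  refine key.congr fun s => ?_
  rw [integral_div]
  congr 1
  have hmono : 0 ≤ expectedOccupancy w (Real.exp s) - expectedOccupancy w (Real.exp (s - a)) := by
    refine sub_nonneg.2 ((hw.summable_one_sub_exp (Real.exp_pos _).le).tsum_le_tsum (fun i => ?_)
      (hw.summable_one_sub_exp (Real.exp_pos _).le))
    have h1 : Real.exp (s - a) * w i ≤ Real.exp s * w i :=
      mul_le_mul_of_nonneg_right (Real.exp_le_exp.2 (by linarith)) (hw.nonneg i)
    linarith [Real.exp_le_exp.2 (neg_le_neg h1)]
  have hm : Measurable fun x => D (s - x) * gumbelDensity x :=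
    (hDm.comp (measurable_const.sub measurable_id)).mul continuous_gumbelDensity.measurable
  rw [integral_eq_lintegral_of_nonneg_ae (ae_of_all _ fun x => mul_nonneg ENNReal.toReal_nonneg
    (gumbelDensity_nonneg x)) hm.aestronglyMeasurable, ← ENNReal.toReal_ofReal hmono,
    ← lintegral_windowCount_mul_gumbelDensity hw ha.le]
  congr 1
  refine lintegral_congr fun x => ?_
  rw [ENNReal.ofReal_mul ENNReal.toReal_nonneg, ENNReal.ofReal_toReal (hw.windowCount_ne_top _ _)]

/-- Passing from windows in logarithmic scale to quotients. -/
theorem tendsto_sub_div_log {H u : ℝ → ℝ}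
    (hH : ∀ a, 0 < a → Tendsto (fun s => (H (Real.exp s) - H (Real.exp (s - a))) / u s) atTop (𝓝 a))
    (hu : ∀ᶠ s in atTop, 0 < u s) (hadd : ∀ b, Tendsto (fun s => u (s + b) / u s) atTop (𝓝 1))
    {c : ℝ} (hc : 0 < c) :
    Tendsto (fun t => (H (c * t) - H t) / u (Real.log t)) atTop (𝓝 (Real.log c)) := by
  have main : Tendsto (fun s => (H (c * Real.exp s) - H (Real.exp s)) / u s) atTop
      (𝓝 (Real.log c)) := by
    obtain ⟨b, rfl⟩ : ∃ b, c = Real.exp b := ⟨Real.log c, (Real.exp_log hc).symm⟩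
    simp only [Real.log_exp, ← Real.exp_add]
    rcases lt_trichotomy b 0 with hb | rfl | hb
    · have h1 := (hH (-b) (by linarith)).neg
      rw [neg_neg] at h1
      refine h1.congr fun s => ?_
      rw [← neg_div, neg_sub, sub_neg_eq_add, add_comm s b]
    · simp
    · have hsh : Tendsto (fun s : ℝ => s + b) atTop atTop :=
        tendsto_atTop_add_const_right _ b tendsto_id
      have h1 := ((hH b hb).comp hsh).mul (hadd b)
      rw [mul_one] at h1
      refine h1.congr' ?_
      filter_upwards [hsh.eventually hu] with s hs
      simp only [Function.comp_apply]
      rw [add_sub_cancel_right, div_mul_div_cancel₀ hs.ne', add_comm s b]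
  refine (main.comp Real.tendsto_log_atTop).congr' ?_
  filter_upwards [eventually_gt_atTop 0] with t ht
  simp only [Function.comp_apply, Real.exp_log ht]

/-- Tangent-line bound for a concave function; termwise it is `1 - exp (-x) ≤ x`. -/
theorem IsWeightFamily.expectedOccupancy_sub_le (hw : IsWeightFamily w) {t c : ℝ} (ht : 0 < t)
    (hc : 1 < c) : expectedOccupancy w (c * t) - expectedOccupancy w t ≤
      (c - 1) * (t * ∑' i, w i * Real.exp (-(t * w i))) := by
  have hct : 0 ≤ c * t := by positivity
  unfold expectedOccupancy
  rw [← (hw.summable_one_sub_exp hct).tsum_sub (hw.summable_one_sub_exp ht.le), ← tsum_mul_left,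
    ← tsum_mul_left]
  refine ((hw.summable_one_sub_exp hct).sub (hw.summable_one_sub_exp ht.le)).tsum_le_tsum
    (fun i => ?_) (((hw.summable_mul_exp ht.le).mul_left _).mul_left _)
  have h1 : Real.exp (-(c * t * w i)) =
      Real.exp (-(t * w i)) * Real.exp (-((c - 1) * (t * w i))) := by
    rw [← Real.exp_add]; ring_nf
  rw [h1]
  nlinarith [Real.add_one_le_exp (-((c - 1) * (t * w i))), Real.exp_pos (-(t * w i))]

theorem IsWeightFamily.le_expectedOccupancy_sub (hw : IsWeightFamily w) {t c : ℝ} (ht : 0 < t)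
    (hc0 : 0 < c) : (1 - c) * (t * ∑' i, w i * Real.exp (-(t * w i))) ≤
      expectedOccupancy w t - expectedOccupancy w (c * t) := by
  have hct : 0 ≤ c * t := by positivity
  unfold expectedOccupancy
  rw [← (hw.summable_one_sub_exp ht.le).tsum_sub (hw.summable_one_sub_exp hct), ← tsum_mul_left,
    ← tsum_mul_left]
  refine (((hw.summable_mul_exp ht.le).mul_left _).mul_left _).tsum_le_tsum
    (fun i => ?_) ((hw.summable_one_sub_exp ht.le).sub (hw.summable_one_sub_exp hct))
  have h1 : Real.exp (-(c * t * w i)) =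
      Real.exp (-(t * w i)) * Real.exp ((1 - c) * (t * w i)) := by
    rw [← Real.exp_add]; ring_nf
  rw [h1]
  nlinarith [Real.add_one_le_exp ((1 - c) * (t * w i)), Real.exp_pos (-(t * w i))]

/-- Monotone density theorem for the expected occupancy. -/
theorem IsWeightFamily.tendsto_mul_deriv (hw : IsWeightFamily w) {g : ℝ → ℝ}
    (hg : ∀ᶠ t in atTop, 0 < g t)
    (hlim : ∀ c, 0 < c → Tendsto (fun t => (expectedOccupancy w (c * t) - expectedOccupancy w t) /
      g t) atTop (𝓝 (Real.log c))) :
    Tendsto (fun t => t * (∑' i, w i * Real.exp (-(t * w i))) / g t) atTop (𝓝 1) := by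
  have hlog : Tendsto (fun c : ℝ => Real.log c / (c - 1)) (𝓝[≠] 1) (𝓝 1) := by
    have := (Real.hasDerivAt_log one_ne_zero).tendsto_slope
    rw [inv_one] at this
    refine this.congr fun c => ?_
    rw [slope_def_field, Real.log_one, sub_zero]
  refine tendsto_order.2 ⟨fun b hb => ?_, fun b hb => ?_⟩
  -- A ratio `c > 1` close to `1` bounds the derivative from below through the forward increment; a
  -- ratio `c < 1` bounds it from above in the other half.
  · have h1 := (hlog.mono_left
      (nhdsWithin_mono (s := Set.Ioi 1) 1 fun _ => ne_of_gt)).eventually_const_lt hb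
    obtain ⟨c, hc, hc1⟩ := (h1.and (self_mem_nhdsWithin (s := Set.Ioi (1 : ℝ)))).exists
    have hc1 : 1 < c := hc1
    rw [lt_div_iff₀ (by linarith)] at hc
    filter_upwards [(hlim c (by linarith)).eventually_const_lt hc, hg, eventually_gt_atTop 0]
      with t h2 hgt ht
    rw [lt_div_iff₀ hgt] at h2 ⊢
    have h3 := hw.expectedOccupancy_sub_le ht hc1
    refine lt_of_mul_lt_mul_left ?_ (sub_pos.2 hc1).le
    linarith
  · have h1 := (hlog.mono_left
      (nhdsWithin_mono (s := Set.Iio 1) 1 fun _ => ne_of_lt)).eventually_lt_const hb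
    obtain ⟨c, ⟨hc, hc1⟩, hc0⟩ := ((h1.and (self_mem_nhdsWithin (s := Set.Iio (1 : ℝ)))).and
      (mem_nhdsWithin_of_mem_nhds (Ioi_mem_nhds (show (0 : ℝ) < 1 from one_pos)))).exists
    have hc1 : c < 1 := hc1
    have hc0 : 0 < c := hc0
    rw [div_lt_iff_of_neg (by linarith)] at hc
    filter_upwards [(hlim c hc0).eventually_const_lt hc, hg, eventually_gt_atTop 0]
      with t h2 hgt ht
    rw [lt_div_iff₀ hgt] at h2
    rw [div_lt_iff₀ hgt]
    have h3 := hw.le_expectedOccupancy_sub ht hc0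
    refine lt_of_mul_lt_mul_left ?_ (sub_pos.2 hc1).le
    linarith

end ExpectedOccupancy

/-! ### The mean number of occupied boxes in the Poissonized scheme. -/

theorem tsum_indicator_one_eq_ncard {α : Type*} {s : Set α} (hs : s.Finite) :
    ∑' x, s.indicator (1 : α → ENNReal) x = (s.ncard : ENNReal) := by
  rw [← tsum_subtype, Pi.one_def, ENNReal.tsum_set_one, ← hs.cast_ncard_eq]
  simp

/-- The product formula over all finite sets of indices is independence of the events, which passes
to their complements. -/
theorem measure_biInter_compl_of_forall {Ω : Type*} [MeasurableSpace Ω] {μ : Measure Ω}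
    [IsProbabilityMeasure μ] {E : ℕ → Set Ω} (hE : ∀ m, MeasurableSet (E m)) {q : ENNReal}
    (h : ∀ S : Finset ℕ, μ (⋂ m ∈ S, E m) = q ^ S.card) (n : ℕ) :
    μ (⋂ m ∈ Finset.range n, (E m)ᶜ) = (1 - q) ^ n := by
  have hq : ∀ m, μ (E m) = q := fun m => by simpa using h {m}
  have hind : iIndepSet E μ := (iIndepSet_iff_meas_biInter hE).2 fun S => by
    rw [h S, Finset.prod_congr rfl fun m _ => hq m, Finset.prod_const]
  have hind' : iIndep (fun m => MeasurableSpace.generateFrom {E m}) μ := hind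
  rw [hind'.meas_biInter fun m _ =>
    (MeasurableSpace.measurableSet_generateFrom (Set.mem_singleton _)).compl]
  rw [Finset.prod_congr rfl fun m _ => (prob_compl_eq_one_sub (hE m)).trans (by rw [hq m]),
    Finset.prod_const, Finset.card_range]

theorem occupied_eq_tsum {Ω : Type*} (N : ℝ≥0 → Ω → ℕ) (X : ℕ → ℕ → Ω → ℕ) (j : ℕ) (t : ℝ≥0)
    (ω : Ω) :
    (occupied N X j t ω : ENNReal) = ∑' r : Fin j → ℕ,
      {ω | ∃ m < N t ω, ∀ i : Fin j, X m i ω = r i}.indicator 1 ω := by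
  have hfin : {r : Fin j → ℕ | ∃ m < N t ω, ∀ i : Fin j, X m i ω = r i}.Finite := by
    refine ((Set.finite_Iio (N t ω)).image fun m (i : Fin j) => X m i ω).subset ?_
    rintro r ⟨m, hm, hr⟩
    exact ⟨m, hm, funext hr⟩
  rw [occupied, occupiedDet, ← tsum_indicator_one_eq_ncard hfin]
  rfl

section Scheme

variable {p : ℕ → ℝ} {Ω : Type*} [MeasurableSpace Ω] {μ : Measure Ω} {N : ℝ≥0 → Ω → ℕ}
  {X : ℕ → ℕ → Ω → ℕ} {j : ℕ}

theorem IsNestedScheme.measurableSet_label (h : IsNestedScheme p N X μ) (r : Fin j → ℕ) (m : ℕ) :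
    MeasurableSet {ω | ∀ i : Fin j, X m i ω = r i} := by
  rw [Set.ofPred_forall]
  exact MeasurableSet.iInter fun i => h.measurable m i (measurableSet_singleton _)

theorem IsNestedScheme.measure_biInter_label (h : IsNestedScheme p N X μ)
    (hp : ∀ k, 0 ≤ p k) (r : Fin j → ℕ) (S : Finset ℕ) :
    μ (⋂ m ∈ S, {ω | ∀ i : Fin j, X m i ω = r i}) = ENNReal.ofReal (weight p r) ^ S.card := by
  -- The word is padded by an arbitrary letter so that the independence of the letters can be
  -- applied over a finite set of pairs of naturals.
  let r' : ℕ → ℕ := fun i => if hi : i < j then r ⟨i, hi⟩ else 0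
  have hset : (⋂ m ∈ S, {ω | ∀ i : Fin j, X m i ω = r i}) =
      ⋂ q ∈ S ×ˢ Finset.range j, (fun ω => X q.1 q.2 ω) ⁻¹' {r' q.2} := by
    ext ω
    simp only [Set.mem_iInter, Set.mem_ofPred_eq, Set.mem_preimage, Set.mem_singleton_iff,
      Finset.mem_product, Finset.mem_range, Prod.forall]
    constructor
    · rintro hω m i ⟨hm, hi⟩
      simpa [r', hi] using hω m hm ⟨i, hi⟩
    · intro hω m hm i
      simpa [r'] using hω m i ⟨hm, i.2⟩
  rw [hset, h.indep.measure_inter_preimage_eq_mul (S ×ˢ Finset.range j)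
    (sets := fun q => {r' q.2}) (fun q _ => measurableSet_singleton _), Finset.prod_product]
  have hlaw : ∀ m i, μ ((fun ω => X m i ω) ⁻¹' {r' i}) = ENNReal.ofReal (p (r' i)) :=
    fun m i => h.law m i (r' i)
  simp only [hlaw, Finset.prod_const]
  congr 1
  rw [weight, ENNReal.ofReal_prod_of_nonneg fun i _ => hp _, Finset.prod_range]
  simp [r']

theorem IsNestedScheme.measure_eq (h : IsNestedScheme p N X μ) (t : ℝ≥0) (n : ℕ) :
    μ {ω | N t ω = n} = ENNReal.ofReal (Real.exp (-t) * t ^ n / n.factorial) := by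
  have h1 := h.poisson.law 0 t (zero_le)
  simp only [h.poisson.zero, tsub_zero] at h1
  rw [← poissonMeasure_singleton, ← h1, Measure.map_apply (h.poisson.measurable t)
    (measurableSet_singleton _)]
  rfl

theorem IsNestedScheme.measurableSet_hit (h : IsNestedScheme p N X μ) (r : Fin j → ℕ) (t : ℝ≥0) :
    MeasurableSet {ω | ∃ m < N t ω, ∀ i : Fin j, X m i ω = r i} := by
  have : {ω | ∃ m < N t ω, ∀ i : Fin j, X m i ω = r i} =
      ⋃ m, {ω | m < N t ω} ∩ {ω | ∀ i : Fin j, X m i ω = r i} := by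
    ext ω; simp
  rw [this]
  exact MeasurableSet.iUnion fun m =>
    (h.poisson.measurable t measurableSet_Ioi).inter (h.measurableSet_label r m)

variable [IsProbabilityMeasure μ]

/-- Split according to `N t = n`: independence gives the Poisson mass times `(1 - q) ^ n`, and
summation gives `exp (-(t * q))`. -/
theorem IsNestedScheme.measure_not_hit (h : IsNestedScheme p N X μ) (hp : ∀ k, 0 ≤ p k)
    (r : Fin j → ℕ) (hr : weight p r ≤ 1) (t : ℝ≥0) :
    μ {ω | ∀ m < N t ω, ¬ ∀ i : Fin j, X m i ω = r i} =
      ENNReal.ofReal (Real.exp (-(t * weight p r))) := by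
  set q := weight p r with hq
  have hq0 : 0 ≤ q := Finset.prod_nonneg fun i _ => hp _
  obtain ⟨-, -, -, -, hNX⟩ := id h
  have hNm := h.poisson.measurable t
  let T : ℕ → Set (ℕ × ℕ → ℕ) := fun n => ⋂ m ∈ Finset.range n, {x | ∀ i : Fin j, x (m, i) = r i}ᶜ
  have hT : ∀ n, MeasurableSet (T n) := fun n => Finset.measurableSet_biInter _ fun m _ => by
    rw [Set.ofPred_forall]
    refine (MeasurableSet.iInter fun i : Fin j => ?_).compl
    have hm : Measurable fun x : ℕ × ℕ → ℕ => x (m, i) := measurable_pi_apply _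
    exact hm (measurableSet_singleton (r i))
  have hpart : ∀ n, μ ({ω | N t ω = n} ∩ (fun ω (q : ℕ × ℕ) => X q.1 q.2 ω) ⁻¹' T n) =
      ENNReal.ofReal (Real.exp (-t) * t ^ n / n.factorial * (1 - q) ^ n) := by
    intro n
    have h1 := hNX.measure_inter_preimage_eq_mul
      ((fun f : ℝ≥0 → ℕ => f t) ⁻¹' {n}) (T n)
      (measurable_pi_apply t (measurableSet_singleton n)) (hT n)
    have h2 : μ ((fun ω (q : ℕ × ℕ) => X q.1 q.2 ω) ⁻¹' T n) = (1 - ENNReal.ofReal q) ^ n := by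
      rw [← measure_biInter_compl_of_forall (h.measurableSet_label r)
        (h.measure_biInter_label hp r) n]
      congr 1
      ext ω
      simp [T]
    refine h1.trans ?_
    rw [h2]
    refine (congrArg (· * _) (h.measure_eq t n)).trans ?_
    rw [ENNReal.ofReal_mul (by positivity), ENNReal.ofReal_pow (by linarith),
      ENNReal.ofReal_sub _ hq0, ENNReal.ofReal_one]
  have hunion : {ω | ∀ m < N t ω, ¬ ∀ i : Fin j, X m i ω = r i} =
      ⋃ n, {ω | N t ω = n} ∩ (fun ω (q : ℕ × ℕ) => X q.1 q.2 ω) ⁻¹' T n := by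
    ext ω
    simp [T]
  rw [hunion, measure_iUnion]
  · simp only [hpart]
    -- Thinning: each term is `exp (-(t * q))` times a Poisson mass with mean `t * (1 - q)`, and
    -- these masses sum to one.
    let s : ℝ≥0 := t * ⟨1 - q, by linarith⟩
    have hs : HasSum (fun n : ℕ => Real.exp (-t) * (t : ℝ) ^ n / n.factorial * (1 - q) ^ n)
        (Real.exp (-(t * q))) := by
      have := (hasSum_one_poissonMeasure s).mul_left (Real.exp (-(t * q)))
      rw [mul_one] at this
      refine this.congr_fun fun n => ?_
      have hs' : (s : ℝ) = t * (1 - q) := rfl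
      have he : Real.exp (-(t : ℝ)) = Real.exp (-(t * q)) * Real.exp (-(t * (1 - q))) := by
        rw [← Real.exp_add]; ring_nf
      rw [hs', he, mul_pow]
      ring
    rw [← ENNReal.ofReal_tsum_of_nonneg (fun n => ?_) hs.summable, hs.tsum_eq]
    have : 0 ≤ 1 - q := by linarith
    positivity
  · intro a b hab
    refine Set.disjoint_left.2 fun ω h1 h2 => hab ?_
    exact h1.1.symm.trans h2.1
  · intro n
    refine (hNm (measurableSet_singleton n)).inter ?_
    exact (measurable_pi_lambda _ fun q => h.measurable q.1 q.2) (hT n)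

theorem IsNestedScheme.measure_hit (h : IsNestedScheme p N X μ) (hp : ∀ k, 0 ≤ p k)
    (r : Fin j → ℕ) (hr : weight p r ≤ 1) (t : ℝ≥0) :
    μ {ω | ∃ m < N t ω, ∀ i : Fin j, X m i ω = r i} =
      ENNReal.ofReal (1 - Real.exp (-(t * weight p r))) := by
  rw [ENNReal.ofReal_sub _ (Real.exp_pos _).le, ← h.measure_not_hit hp r hr t, ENNReal.ofReal_one,
    ← compl_compl {ω | ∃ m < N t ω, ∀ i : Fin j, X m i ω = r i},
    prob_compl_eq_one_sub (h.measurableSet_hit r t).compl]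
  congr 2
  ext ω
  simp

/-- The number of occupied boxes is integrable, and its mean is the expected occupancy. -/
theorem IsNestedScheme.integrable_occupied (h : IsNestedScheme p N X μ) (hp : ∀ k, 0 ≤ p k)
    (hw : IsWeightFamily fun r : Fin j → ℕ => weight p r) {t : ℝ} (ht : 0 ≤ t) :
    Integrable (fun ω => (occupied N X j t.toNNReal ω : ℝ)) μ ∧
      meanOccupied N X μ j t = expectedOccupancy (fun r : Fin j → ℕ => weight p r) t := by
  have hsum := hw.summable_one_sub_exp ht
  have hnn : ∀ r : Fin j → ℕ, 0 ≤ 1 - Real.exp (-(t * weight p r)) := fun r => by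
    have := mul_nonneg ht (hw.nonneg r)
    linarith [Real.exp_le_one_iff.2 (neg_nonpos.2 this)]
  have hm : ∀ r : Fin j → ℕ, Measurable
      ({ω | ∃ m < N t.toNNReal ω, ∀ i : Fin j, X m i ω = r i}.indicator (1 : Ω → ENNReal)) :=
    fun r => measurable_one.indicator (h.measurableSet_hit r _)
  have hmK : Measurable fun ω => (occupied N X j t.toNNReal ω : ENNReal) := by
    simp only [occupied_eq_tsum]
    exact Measurable.tsum hm
  have hmR : Measurable fun ω => (occupied N X j t.toNNReal ω : ℝ) := by
    simpa using hmK.ennreal_toReal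
  have hl : ∫⁻ ω, (occupied N X j t.toNNReal ω : ENNReal) ∂μ =
      ENNReal.ofReal (expectedOccupancy (fun r : Fin j → ℕ => weight p r) t) := by
    simp only [occupied_eq_tsum]
    rw [lintegral_tsum fun r => (hm r).aemeasurable, expectedOccupancy,
      ENNReal.ofReal_tsum_of_nonneg hnn hsum]
    refine tsum_congr fun r => ?_
    rw [lintegral_indicator_one (h.measurableSet_hit r _), h.measure_hit hp r (hw.le_one r),
      Real.coe_toNNReal t ht]
  have hofReal : ∀ ω, ENNReal.ofReal (occupied N X j t.toNNReal ω : ℝ) =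
      (occupied N X j t.toNNReal ω : ENNReal) := fun ω => ENNReal.ofReal_natCast _
  refine ⟨⟨hmR.aestronglyMeasurable, ?_⟩, ?_⟩
  · rw [hasFiniteIntegral_iff_ofReal (ae_of_all _ fun ω => Nat.cast_nonneg _)]
    simp only [hofReal, hl]
    exact ENNReal.ofReal_lt_top
  · rw [meanOccupied, integral_eq_lintegral_of_nonneg_ae (ae_of_all _ fun ω => Nat.cast_nonneg _)
      hmR.aestronglyMeasurable]
    simp only [hofReal, hl]
    exact ENNReal.toReal_ofReal (tsum_nonneg hnn)

end Scheme

/-! ### Window densities of the generations, by induction on word length. -/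

section Generations

theorem IsWeightFamily.toReal_windowCount {I : Type*} {w : I → ℝ} (hw : IsWeightFamily w) {a : ℝ}
    (ha : 0 ≤ a) (s : ℝ) :
    (windowCount w a s).toReal = (Set.ncard {i | 1 / Real.exp s ≤ w i} : ℝ) -
      (Set.ncard {i | 1 / Real.exp (s - a) ≤ w i} : ℝ) := by
  have hfin : {i | 1 / Real.exp s ≤ w i}.Finite := by
    have := hw.summable.tendsto_cofinite_zero.eventually_lt_const
      (show 0 < 1 / Real.exp s by positivity)
    refine (eventually_cofinite.1 this).subset fun i hi => not_lt.2 hi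
  have hsub : {i | 1 / Real.exp (s - a) ≤ w i} ⊆ {i | 1 / Real.exp s ≤ w i} := by
    intro i (hi : 1 / Real.exp (s - a) ≤ w i)
    refine le_trans ?_ hi
    gcongr
    linarith
  have hwin : windowCount w a s =
      (({i | 1 / Real.exp s ≤ w i} \ {i | 1 / Real.exp (s - a) ≤ w i}).ncard : ENNReal) := by
    rw [← tsum_indicator_one_eq_ncard hfin.sdiff]
    refine tsum_congr fun i => ?_
    simp only [Set.indicator_apply, Set.mem_Ico, Set.mem_sdiff, Set.mem_ofPred_eq, not_le, one_div,
      ← Real.exp_neg, neg_sub, Pi.one_apply]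
  have h1 := Set.ncard_sdiff_add_ncard_of_subset hsub hfin
  rw [hwin, ENNReal.toReal_natCast, ← h1]
  push_cast
  ring

theorem weight_consEquiv (p : ℕ → ℝ) {j : ℕ} (q : ℕ × (Fin j → ℕ)) :
    weight p (Fin.consEquiv (fun _ : Fin (j + 1) => ℕ) q) = p q.1 * weight p q.2 := by
  simp [weight, Fin.consEquiv, Fin.prod_univ_succ]

theorem isWeightFamily_weight {p : ℕ → ℝ} (hp : IsWeightFamily p) (j : ℕ) :
    IsWeightFamily fun r : Fin j → ℕ => weight p r := by
  refine ⟨fun r => Finset.prod_nonneg fun i _ => hp.nonneg _,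
    fun r => Finset.prod_le_one (fun i _ => hp.nonneg _) fun i _ => hp.le_one _, ?_⟩
  induction j with
  | zero => exact (hasSum_fintype _).summable
  | succ j ih =>
    rw [← (Fin.consEquiv fun _ : Fin (j + 1) => ℕ).summable_iff]
    refine (hp.summable.mul_of_nonneg ih hp.nonneg fun r =>
      Finset.prod_nonneg fun i _ => hp.nonneg _).congr fun q => ?_
    exact (weight_consEquiv p q).symm

theorem HasWindowDensity.congr {I : Type*} {w : I → ℝ} {u v : ℝ → ℝ} (h : HasWindowDensity w u)
    (huv : ∀ᶠ s in atTop, u s = v s) : HasWindowDensity w v := by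
  refine ⟨?_, fun a ha => (h.2 a ha).congr' ?_⟩
  · filter_upwards [h.1, huv] with s h1 h2
    rwa [← h2]
  · filter_upwards [huv] with s h2
    rw [h2]

/-- The window density of the words of length `j`. -/
noncomputable def genDensity (β : ℝ) (ℓ : ℝ → ℝ) (j : ℕ) (s : ℝ) : ℝ :=
  haanConst β j * (s ^ ((j : ℝ) * β + (j : ℝ) - 1) * ℓ s ^ j)

theorem haanConst_pos {β : ℝ} (hβ : 0 ≤ β) {j : ℕ} (hj : 1 ≤ j) : 0 < haanConst β j := by
  have hj' : (0 : ℝ) < j := by exact_mod_cast hj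
  exact div_pos (pow_pos (Real.Gamma_pos_of_pos (by linarith)) _)
    (Real.Gamma_pos_of_pos (mul_pos hj' (by linarith)))

theorem haanConst_one {β : ℝ} (hβ : 0 ≤ β) : haanConst β 1 = 1 := by
  have := Real.Gamma_pos_of_pos (show 0 < β + 1 by linarith)
  simp [haanConst, this.ne']

/-- In `Γ(j(β+1)) Γ(β+1) / Γ((j+1)(β+1))` the first factor cancels the denominator of `haanConst β
j`. -/
theorem beta_mul_haanConst {β : ℝ} (hβ : 0 ≤ β) {j : ℕ} (hj : 1 ≤ j) :
    beta ((j : ℝ) * β + j - 1 + 1) (β + 1) * haanConst β j = haanConst β (j + 1) := by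
  have hj' : (0 : ℝ) < j := by exact_mod_cast hj
  have h1 : 0 < (j : ℝ) * (β + 1) := mul_pos hj' (by linarith)
  have := (Real.Gamma_pos_of_pos h1).ne'
  rw [beta, haanConst, haanConst, show (j : ℝ) * β + j - 1 + 1 = j * (β + 1) by ring]
  push_cast
  rw [show (j : ℝ) * (β + 1) + (β + 1) = (j + 1) * (β + 1) by ring]
  field_simp
  ring

theorem tendsto_genDensity_mul_div {β : ℝ} (hβ : 0 ≤ β) {ℓ : ℝ → ℝ} (hℓ : SlowlyVarying ℓ) {j : ℕ}
    (hj : 1 ≤ j) {c : ℝ} (hc : 0 < c) :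
    Tendsto (fun s => genDensity β ℓ j (c * s) / genDensity β ℓ j s) atTop
      (𝓝 (c ^ ((j : ℝ) * β + (j : ℝ) - 1))) := by
  have h1 := ((hℓ.2 c hc).pow j).const_mul (c ^ ((j : ℝ) * β + (j : ℝ) - 1))
  rw [one_pow, mul_one] at h1
  refine h1.congr' ?_
  filter_upwards [eventually_gt_atTop 0] with s hs
  have hC := (haanConst_pos hβ hj).ne'
  have hr := (Real.rpow_pos_of_pos hs ((j : ℝ) * β + (j : ℝ) - 1)).ne'
  unfold genDensity
  rw [Real.mul_rpow hc.le hs.le, mul_div_mul_left _ _ hC, mul_assoc, mul_left_comm,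
    ← div_mul_div_comm, div_pow, div_self hr, one_mul, mul_div_assoc]

/-- The window densities of all generations. -/
theorem hasWindowDensity_weight {p : ℕ → ℝ} (hp : IsWeightFamily p) {β : ℝ} (hβ : 0 ≤ β)
    {ℓ : ℝ → ℝ} (hℓ : SlowlyVarying ℓ) (h : HasWindowDensity p (genDensity β ℓ 1)) {j : ℕ}
    (hj : 1 ≤ j) : HasWindowDensity (fun r : Fin j → ℕ => weight p r) (genDensity β ℓ j) := by
  induction j, hj using Nat.le_induction with
  | base =>
    have he : (fun r : Fin 1 → ℕ => weight p r) = fun r => p (Equiv.funUnique (Fin 1) ℕ r) := by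
      funext r
      simp [weight]
    rw [he]
    refine ⟨h.1, fun a ha => ?_⟩
    simp only [windowCount_comp_equiv (Equiv.funUnique (Fin 1) ℕ) p]
    exact h.2 a ha
  | succ j hj ih =>
    have hj' : (1 : ℝ) ≤ j := by exact_mod_cast hj
    have hjβ : 0 ≤ (j : ℝ) * β := by positivity
    -- A word of length `j + 1` is a letter, of index `β`, followed by a word of length `j`, of
    -- index `jβ + j - 1`; the convolution contributes one more power of `s`.
    have h1 := h.prod hp (isWeightFamily_weight hp j) ih (α := β) (β := (j : ℝ) * β + j - 1) hβ
      (by linarith)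
      (fun c hc => by simpa using tendsto_genDensity_mul_div hβ hℓ le_rfl hc)
      (fun c hc => tendsto_genDensity_mul_div hβ hℓ hj hc)
    have h2 : HasWindowDensity (fun q : ℕ × (Fin j → ℕ) => p q.1 * weight p q.2)
        (genDensity β ℓ (j + 1)) := by
      refine h1.congr ?_
      filter_upwards [eventually_gt_atTop 0] with s hs
      have hpow : s ^ (((j + 1 : ℕ) : ℝ) * β + ((j + 1 : ℕ) : ℝ) - 1) =
          s * s ^ β * s ^ ((j : ℝ) * β + j - 1) := by
        nth_rewrite 2 [← Real.rpow_one s]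
        rw [← Real.rpow_add hs, ← Real.rpow_add hs]
        push_cast
        ring_nf
      simp only [genDensity]
      rw [hpow, ← beta_mul_haanConst hβ hj, haanConst_one hβ]
      simp only [Nat.cast_one, one_mul, add_sub_cancel_right, pow_succ]
      ring
    refine ⟨h2.1, fun a ha => (h2.2 a ha).congr fun s => ?_⟩
    rw [← windowCount_comp_equiv (Fin.consEquiv fun _ : Fin (j + 1) => ℕ)]
    simp only [weight_consEquiv]

theorem genDensity_log (β : ℝ) (ℓ : ℝ → ℝ) (j : ℕ) (t : ℝ) :
    genDensity β ℓ j (Real.log t) = haanConst β j * haanAux β ℓ j t := rfl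

/-- As `f` is only a.e. measurable, preimages of null sets under `log` must be null; they are images
under the differentiable map `exp`. -/
theorem aemeasurable_comp_log {f : ℝ → ℝ} {x : ℝ}
    (hf : AEMeasurable f (volume.restrict (Set.Ici x))) :
    AEMeasurable (fun t => f (Real.log t)) (volume.restrict (Set.Ici (Real.exp x))) := by
  refine hf.comp_quasiMeasurePreserving (f := Real.log) ⟨Real.measurable_log, ?_⟩
  refine Measure.AbsolutelyContinuous.mk fun s hs h0 => ?_
  rw [Measure.map_apply Real.measurable_log hs,
    Measure.restrict_apply (Real.measurable_log hs)]
  rw [Measure.restrict_apply hs] at h0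
  refine measure_mono_null ?_ (addHaar_image_eq_zero_of_differentiableOn_of_addHaar_eq_zero volume
    Real.differentiable_exp.differentiableOn h0)
  rintro t ⟨ht, hxt : Real.exp x ≤ t⟩
  have ht0 : 0 < t := (Real.exp_pos x).trans_le hxt
  exact ⟨Real.log t, ⟨ht, (Real.le_log_iff_exp_le ht0).2 hxt⟩, Real.exp_log ht0⟩

theorem slowlyVarying_haanAux {I : Type*} {w : I → ℝ} (hw : IsWeightFamily w) {β : ℝ} (hβ : 0 ≤ β)
    {ℓ : ℝ → ℝ} (hℓ : SlowlyVarying ℓ) {j : ℕ} (hj : 1 ≤ j)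
    (h : HasWindowDensity w (genDensity β ℓ j)) : SlowlyVarying (haanAux β ℓ j) := by
  obtain ⟨⟨x, hm, hpos⟩, -⟩ := hℓ
  have hC := haanConst_pos hβ hj
  -- Beyond this point `log t ≥ 1`, so the real power is positive, and `log t ≥ x`, so `ℓ (log t)`
  -- is.
  refine ⟨⟨Real.exp (max x 1), ?_, fun t ht => ?_⟩, fun c hc => ?_⟩
  · have h1 := aemeasurable_comp_log (hm.mono_measure
      (Measure.restrict_mono (Set.Ici_subset_Ici.2 (le_max_left x 1)) le_rfl))
    exact (Real.measurable_log.pow_const _).aemeasurable.mul (h1.pow_const j)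
  · have ht0 : 0 < t := (Real.exp_pos _).trans_le ht
    have hlog : max x 1 ≤ Real.log t := (Real.le_log_iff_exp_le ht0).2 ht
    exact mul_pos (Real.rpow_pos_of_pos (by linarith [le_max_right x 1]) _)
      (pow_pos (hpos _ ((le_max_left x 1).trans hlog)) j)
  · refine ((h.tendsto_add_div hw (Real.log c)).comp Real.tendsto_log_atTop).congr' ?_
    filter_upwards [eventually_gt_atTop 0] with t ht
    simp only [Function.comp_apply]
    rw [← Real.log_mul ht.ne' hc.ne', mul_comm t c, genDensity_log, genDensity_log,
      mul_div_mul_left _ _ hC.ne']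

theorem deHaanPi_of_window {I : Type*} {w : I → ℝ} (hw : IsWeightFamily w) {β : ℝ} (hβ : 0 ≤ β)
    {ℓ : ℝ → ℝ} (hℓ : SlowlyVarying ℓ) {j : ℕ} (hj : 1 ≤ j)
    (h : HasWindowDensity w (genDensity β ℓ j)) {H : ℝ → ℝ}
    (hH : ∀ a, 0 < a → Tendsto (fun s => (H (Real.exp s) - H (Real.exp (s - a))) /
      genDensity β ℓ j s) atTop (𝓝 a)) :
    DeHaanPi H (haanAux β ℓ j) (haanConst β j) := by
  have hC := haanConst_pos hβ hj
  refine ⟨slowlyVarying_haanAux hw hβ hℓ hj h, fun c hc => ?_⟩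
  refine ((tendsto_sub_div_log hH h.1 (h.tendsto_add_div hw) hc).const_mul
    (haanConst β j)).congr fun t => ?_
  rw [genDensity_log, ← div_div, div_right_comm, mul_div_cancel₀ _ hC.ne']

end Generations

end NestedKarlin

/-! ### Assembly of the theorem. -/

open NestedKarlin in
theorem proposition4p4
    (p : ℕ → ℝ) (hp_nonneg : ∀ k, 0 ≤ p k) (hp_sum : HasSum p 1)
    (hp_inf : {k : ℕ | 0 < p k}.Infinite)
    (β : ℝ) (hβ : 0 ≤ β) (ℓ : ℝ → ℝ) (hℓ : NestedKarlin.SlowlyVarying ℓ)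
    (hρ : ∀ c : ℝ, 0 < c →
      Tendsto
        (fun t => (NestedKarlin.rho p (c * t) - NestedKarlin.rho p t) /
          (Real.log t ^ β * ℓ (Real.log t)))
        atTop (𝓝 (Real.log c)))
    (hℓ0 : β = 0 → (∃ x₀ : ℝ, MonotoneOn ℓ (Set.Ici x₀)) ∧ Tendsto ℓ atTop atTop)
    {Ω : Type*} [MeasurableSpace Ω] (μ : Measure Ω) [IsProbabilityMeasure μ]
    (N : ℝ≥0 → Ω → ℕ) (X : ℕ → ℕ → Ω → ℕ)
    (hscheme : NestedKarlin.IsNestedScheme p N X μ)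
    (j : ℕ) (hj : 1 ≤ j) :
    -- the mean is finite and given by the series
    (∀ t : ℝ, 0 ≤ t →
      Integrable (fun ω => (NestedKarlin.occupied N X j t.toNNReal ω : ℝ)) μ ∧
      HasSum (fun r : Fin j → ℕ => 1 - Real.exp (-(t * NestedKarlin.weight p r)))
        (NestedKarlin.meanOccupied N X μ j t)) ∧
    -- the mean and the counting function belong to de Haan's class, with the same data
    NestedKarlin.DeHaanPi (NestedKarlin.meanOccupied N X μ j)
      (NestedKarlin.haanAux β ℓ j) (NestedKarlin.haanConst β j) ∧
    NestedKarlin.DeHaanPi (NestedKarlin.rhoGen p j)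
      (NestedKarlin.haanAux β ℓ j) (NestedKarlin.haanConst β j) ∧
    -- the derivative of the mean and its asymptotics
    (∀ t : ℝ, 0 < t → ∃ d : ℝ,
      HasSum (fun r : Fin j → ℕ =>
        NestedKarlin.weight p r * Real.exp (-(t * NestedKarlin.weight p r))) d ∧
      HasDerivAt (NestedKarlin.meanOccupied N X μ j) d t) ∧
    Asymptotics.IsEquivalent atTop (deriv (NestedKarlin.meanOccupied N X μ j))
      (fun t => NestedKarlin.haanConst β j * NestedKarlin.haanAux β ℓ j t / t) := by
  have hp : IsWeightFamily p :=
    ⟨hp_nonneg, fun k => le_hasSum hp_sum k fun i _ => hp_nonneg i, hp_sum.summable⟩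
  have hbase : HasWindowDensity p (genDensity β ℓ 1) := by
    have hgen : ∀ s, genDensity β ℓ 1 s = s ^ β * ℓ s := fun s => by
      simp [genDensity, haanConst_one hβ]
    obtain ⟨⟨x, -, hpos⟩, -⟩ := hℓ
    refine ⟨?_, fun a ha => ?_⟩
    · filter_upwards [eventually_gt_atTop 0, eventually_ge_atTop x] with s hs hx
      rw [hgen]
      exact mul_pos (Real.rpow_pos_of_pos hs β) (hpos s hx)
    -- At ratio `exp (-a)` and `t = exp s`, minus the increment of `rho` is exactly the window
    -- count.
    · have h1 := ((hρ (Real.exp (-a)) (Real.exp_pos _)).comp Real.tendsto_exp_atTop).neg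
      rw [Real.log_exp, neg_neg] at h1
      refine h1.congr fun s => ?_
      simp only [Function.comp_apply]
      rw [hp.toReal_windowCount ha.le, hgen, ← neg_div, neg_sub, ← Real.exp_add, Real.log_exp,
        neg_add_eq_sub]
      rfl
  have hw := isWeightFamily_weight hp j
  have hdens := hasWindowDensity_weight hp hβ hℓ hbase hj
  have hmean : ∀ t, 0 ≤ t →
      meanOccupied N X μ j t = expectedOccupancy (fun r : Fin j → ℕ => weight p r) t :=
    fun t ht => (hscheme.integrable_occupied hp_nonneg hw ht).2
  -- The mean is constant on negative times, so it agrees with the series only for `t ≥ 0`; this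
  -- contains a neighbourhood of each positive `t`.
  have hderiv : ∀ t, 0 < t → HasDerivAt (meanOccupied N X μ j)
      (∑' r : Fin j → ℕ, weight p r * Real.exp (-(t * weight p r))) t := fun t ht =>
    (hw.hasDerivAt_expectedOccupancy ht).congr_of_eventuallyEq
      ((eventually_gt_nhds ht).mono fun s hs => hmean s hs.le)
  have hpi := deHaanPi_of_window hw hβ hℓ hj hdens (H := meanOccupied N X μ j) fun a ha => by
    simp only [hmean _ (Real.exp_pos _).le]
    exact hdens.tendsto_expectedOccupancy_sub hw ha
  refine ⟨fun t ht => ⟨(hscheme.integrable_occupied hp_nonneg hw ht).1, ?_⟩, hpi,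
    deHaanPi_of_window hw hβ hℓ hj hdens fun a ha => (hdens.2 a ha).congr fun s => ?_,
    fun t ht => ⟨_, (hw.summable_mul_exp ht.le).hasSum, hderiv t ht⟩, ?_⟩
  · rw [hmean t ht]
    exact (hw.summable_one_sub_exp ht).hasSum
  · rw [hw.toReal_windowCount ha.le]
    rfl
  · have hpos : ∀ᶠ t in atTop, 0 < genDensity β ℓ j (Real.log t) :=
      Real.tendsto_log_atTop.eventually hdens.1
    have h1 := hw.tendsto_mul_deriv hpos fun c hc => tendsto_sub_div_log
      (fun a ha => hdens.tendsto_expectedOccupancy_sub hw ha) hdens.1 (hdens.tendsto_add_div hw) hc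
    refine Asymptotics.isEquivalent_of_tendsto_one (h1.congr' ?_)
    filter_upwards [eventually_gt_atTop 0] with t ht
    rw [Pi.div_apply, (hderiv t ht).deriv, ← genDensity_log, div_div_eq_mul_div, mul_comm t]
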